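/- Let $n\ge 1$, $m_1,m_2\ge 0$ be integers, $m=m_1+m_2\geq 1$, $p_{\mathrm{fail}}=m_2/m$. Let $a_1,\dots,a_m$ be i.i.d. random vectors in $\mathbb{R}^n$, distributed as a generic random vector $a$ that has mean $0$ and covariance matrix $\Sigma$ and is $\sigma^2$-subGaussian, i.e. $\mathbb{E}\,e^{\langle v,a\rangle}\le e^{\sigma^2\|v\|_2^2/2}$ for all $v\in\mathbb{R}^n$. Let $x_\star\in\mathbb{R}^n\setminus\{0\}$, let $b_i=\langle a_i,x_\star\rangle^2$ for $i\le m_1$ and $b_i=\xi_i$ for $m_1<i\le m$, where the $\xi_i$ are nonnegative random variables with an arbitrary joint distribution (they may depend on the $a_i$). For $x\in\mathbb{R}^n$ put $$r_i(x)=\big|\langle a_i,x\rangle^2-b_i\big|,\qquad F(x)=\frac1m\sum_{i=1}^m r_i(x),$$ and, for $\tilde p\in(0,1)$ with $m\tilde p\in\mathbb{N}$, let $r^{\tilde p}(x)$ be the $(m\tilde p)$-th smallest of the numbers $r_1(x),\dots,r_m(x)$ (counted with multiplicity). Let $\|\Sigma\|_2$ be the spectral norm, let $\mathbb{S}^{n-1}$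 be the Euclidean unit sphere, and let $$\kappa_{\mathrm{st}}=\inf_{u,v\in\mathbb{S}^{n-1}}\mathbb{E}\,|\langle a,u\rangle\langle a,v\rangle|,\qquad p_0=\inf_{u,v\in\mathbb{S}^{n-1}}\mathbb{P}\big(\min\{|\langle a,u\rangle|,|\langle a,v\rangle|\}\ge\kappa\big),$$ where $\kappa>0$. Theorem. Assume that $p_{\mathrm{fail}}<\tfrac12$, $\kappa_{\mathrm{st}}-2p_{\mathrm{fail}}\|\Sigma\|_2>0$, $\tilde p\in(p_{\mathrm{fail}},1-p_{\mathrm{fail}})$, $m\tilde p\in\mathbb{N}$ and $p_0>\dfrac{1-\tilde p}{1-p_{\mathrm{fail}}}$. Then there are positive constants $u_L,u_H,\rho_1,\rho_2,\rho_3$, depending only on $\|\Sigma\|_2,\sigma,\kappa_{\mathrm{st}},\kappa,p_0,p_{\mathrm{fail}},\tilde p$ (in particular not on $n$, $m$, $x_\star$, or the distribution of the corruptions), such that whenever $m\ge\rho_1 n$, $$\mathbb{P}\Big(u_L\big(F(x)-F(x_\star)\big)\le r^{\tilde p}(x)\le u_H\big(F(x)-F(x_\star)\big)\ \text{ for all }x\in\mathbb{R}^n\Big)\ge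 1-\rho_2e^{-\rho_3m}.$$ -/

import Mathlib

open MeasureTheory ProbabilityTheory
open scoped NNReal

namespace RobustPhaseRetrieval

noncomputable section

/-- The law `ν` on `ℝⁿ` is `σ²`-subGaussian (as a centered law): for every direction `v` and every
real `t`, `∫ exp (t ⟨v, y⟩) dν(y) ≤ exp (σ² ‖v‖² t² / 2)`. -/
def IsSubGaussian {n : ℕ} (ν : Measure (EuclideanSpace ℝ (Fin n))) (σ : ℝ≥0) : Prop :=
  ∀ v : EuclideanSpace ℝ (Fin n),
    HasSubgaussianMGF (fun y => inner ℝ v y) (σ ^ 2 * ‖v‖₊ ^ 2) ν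

/-- The covariance matrix `Σ` of a law on `ℝⁿ`. -/
def covarianceMatrix {n : ℕ} (ν : Measure (EuclideanSpace ℝ (Fin n))) : Matrix (Fin n) (Fin n) ℝ :=
  Matrix.of fun i j => covariance (fun y => y i) (fun y => y j) ν

/-- The spectral norm `‖M‖₂` of a square matrix, its operator norm for the Euclidean norm. -/
def specNorm {n : ℕ} (M : Matrix (Fin n) (Fin n) ℝ) : ℝ :=
  ‖Matrix.toEuclideanCLM (n := Fin n) (𝕜 := ℝ) M‖

/-- The stability constant `κ_st = inf_{u, v ∈ 𝕊ⁿ⁻¹} 𝔼 |⟨a, u⟩ ⟨a, v⟩|`, where `a` has law `ν`. -/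
def kappaSt {n : ℕ} (ν : Measure (EuclideanSpace ℝ (Fin n))) : ℝ :=
  ⨅ u : Metric.sphere (0 : EuclideanSpace ℝ (Fin n)) 1,
    ⨅ v : Metric.sphere (0 : EuclideanSpace ℝ (Fin n)) 1,
      ∫ y, |inner ℝ y (u : EuclideanSpace ℝ (Fin n)) *
        inner ℝ y (v : EuclideanSpace ℝ (Fin n))| ∂ν

/-- `inf_{u, v ∈ 𝕊ⁿ⁻¹} ℙ (min {|⟨a, u⟩|, |⟨a, v⟩|} ≥ κ)`, where `a` has law `ν`. -/
def smallBallProb {n : ℕ} (ν : Measure (EuclideanSpace ℝ (Fin n))) (κ : ℝ) : ℝ :=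
  ⨅ u : Metric.sphere (0 : EuclideanSpace ℝ (Fin n)) 1,
    ⨅ v : Metric.sphere (0 : EuclideanSpace ℝ (Fin n)) 1,
      ν.real {y | κ ≤ min |inner ℝ y (u : EuclideanSpace ℝ (Fin n))|
        |inner ℝ y (v : EuclideanSpace ℝ (Fin n))|}

/-- The measurements `b`: the first `m₁` are the exact values `⟨a_i, x⋆⟩²`, the last `m₂` are
the corruptions `ξ`. -/
def measurements {n m₁ m₂ : ℕ} (a : Fin (m₁ + m₂) → EuclideanSpace ℝ (Fin n))
    (xs : EuclideanSpace ℝ (Fin n)) (ξ : Fin m₂ → ℝ) : Fin (m₁ + m₂) → ℝ :=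
  Fin.append (fun i : Fin m₁ => (inner ℝ (a (Fin.castAdd m₂ i)) xs) ^ 2) ξ

/-- The absolute absResidual `r_i(x) = |⟨a_i, x⟩² - b_i|`. -/
def absResidual {n m : ℕ} (a : Fin m → EuclideanSpace ℝ (Fin n)) (b : Fin m → ℝ)
    (x : EuclideanSpace ℝ (Fin n)) (i : Fin m) : ℝ :=
  |(inner ℝ (a i) x) ^ 2 - b i|

/-- The `ℓ₁` objective `F(x) = (1/m) ∑ᵢ |⟨a_i, x⟩² - b_i|`. -/
def objective {n m : ℕ} (a : Fin m → EuclideanSpace ℝ (Fin n)) (b : Fin m → ℝ)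
    (x : EuclideanSpace ℝ (Fin n)) : ℝ :=
  (1 / (m : ℝ)) * ∑ i, absResidual a b x i

/-- The `k`-th order statistic `r_(k)` of `r_1, …, r_m`, for `1 ≤ k ≤ m` (and `0` for other `k`):
the `k`-th entry after sorting in increasing order. -/
def orderStat {m : ℕ} (r : Fin m → ℝ) (k : ℕ) : ℝ :=
  if h : 1 ≤ k ∧ k ≤ m then r (Tuple.sort r ⟨k - 1, by omega⟩) else 0

/-- The `p`-quantile of `r_1, …, r_m`: the order statistic of index `m p`, used when `m p` is
a natural number. -/
def quantile {m : ℕ} (r : Fin m → ℝ) (p : ℝ) : ℝ :=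
  orderStat r ⌊(m : ℝ) * p⌋₊

/-- The data model: the `a_i` are independent with common law `ν`, which has mean `0` and is
`σ²`-subGaussian; the signal `x⋆` is nonzero; the corruptions are nonnegative random variables with
an arbitrary joint distribution, possibly dependent on each other and on the `a_i`. -/
structure DataModel {n m₁ m₂ : ℕ} {Ω : Type*} [MeasurableSpace Ω] (μ : Measure Ω)
    (ν : Measure (EuclideanSpace ℝ (Fin n))) (σ : ℝ≥0)
    (a : Fin (m₁ + m₂) → Ω → EuclideanSpace ℝ (Fin n)) (ξ : Fin m₂ → Ω → ℝ)
    (xs : EuclideanSpace ℝ (Fin n)) : Prop where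
  measurable_a : ∀ i, Measurable (a i)
  law_a : ∀ i, μ.map (a i) = ν
  indep_a : iIndepFun a μ
  mean_zero : ∫ y, y ∂ν = 0
  subGaussian : IsSubGaussian ν σ
  signal_ne_zero : xs ≠ 0
  measurable_xi : ∀ j, Measurable (ξ j)
  xi_nonneg : ∀ j, ∀ᵐ ω ∂μ, 0 ≤ ξ j ω

end

end RobustPhaseRetrieval

open RobustPhaseRetrieval

/-!
On the clean samples `r_i(x) = |⟨a_i, x - x⋆⟩ ⟨a_i, x + x⋆⟩|`, and on every sample
`|r_i(x) - r_i(x⋆)|` is at most this product. Hence, with `d = ‖x - x⋆‖ ‖x + x⋆‖`, both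
`F(x) - F(x⋆)` and the quantile of the residuals are of order `d` as soon as three bounds hold
uniformly over unit vectors `u`, `v`: the sum of `|⟨a_i, u⟩ ⟨a_i, v⟩|` over the clean samples
exceeds that over the corrupted samples by a multiple of `m`, the sum over all samples is at most a
multiple of `m`, and more than `(1 - p̃) m` clean samples have both factors bounded below.

The products are sub-exponential, so Chernoff bounds give these estimates on a net of the sphere,
and the norm of the sampling operator, itself controlled on the net, transfers them to the whole
sphere. All estimates are uniform in `x⋆` and in the values of the corruptions.
-/

open scoped RealInnerProductSpace ENNReal

namespace RobustPhaseRetrieval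

section OrderStatistics

open Finset

lemma card_filter_le_mul_le_sum {ι : Type*} {s : Finset ι} {f : ι → ℝ} (hf : ∀ i ∈ s, 0 ≤ f i)
    (t : ℝ) : (#{i ∈ s | t ≤ f i} : ℝ) * t ≤ ∑ i ∈ s, f i :=
  calc (#{i ∈ s | t ≤ f i} : ℝ) * t = #{i ∈ s | t ≤ f i} • t := (nsmul_eq_mul _ _).symm
    _ ≤ ∑ i ∈ s with t ≤ f i, f i := card_nsmul_le_sum _ _ _ fun _ hi => (mem_filter.1 hi).2
    _ ≤ ∑ i ∈ s, f i := sum_le_sum_of_subset_of_nonneg (filter_subset _ _) fun i hi _ => hf i hi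

variable {m k : ℕ} {r : Fin m → ℝ}

lemma le_orderStat_iff (hk : 1 ≤ k) (hkm : k ≤ m) {t : ℝ} :
    t ≤ orderStat r k ↔ #{i | r i < t} < k := by
  have hsorted : #{j | (r ∘ Tuple.sort r) j < t} = #{i | r i < t} :=
    card_equiv (Tuple.sort r) fun j => by simp only [mem_filter_univ, Function.comp_apply]
  have hiff := Tuple.lt_card_lt_iff_apply_lt_of_monotone (j := ⟨k - 1, by lia⟩) (a := t)
    (Tuple.monotone_sort r)
  rw [hsorted, Function.comp_apply] at hiff
  rw [orderStat, dif_pos ⟨hk, hkm⟩, ← not_lt, ← hiff, not_lt]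
  lia

lemma orderStat_nonneg (hr : ∀ i, 0 ≤ r i) : 0 ≤ orderStat r k := by
  rw [orderStat]
  split_ifs
  exacts [hr _, le_rfl]

lemma card_sub_mul_orderStat_le_sum (hk : 1 ≤ k) (hkm : k ≤ m) (hr : ∀ i, 0 ≤ r i)
    (s : Finset (Fin m)) : ((#s : ℝ) - k) * orderStat r k ≤ ∑ i ∈ s, r i := by
  set t := orderStat r k with ht
  have hbelow : #{i ∈ s | ¬ t ≤ r i} ≤ k :=
    (card_le_card fun i => by simp).trans ((le_orderStat_iff hk hkm).1 ht.le).le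
  have habove : (#s : ℝ) - k ≤ #{i ∈ s | t ≤ r i} := by
    have hsplit := card_filter_add_card_filter_not (s := s) (fun i => t ≤ r i)
    rw [sub_le_iff_le_add]
    exact_mod_cast (hsplit ▸ Nat.add_le_add_left hbelow _ : #s ≤ #{i ∈ s | t ≤ r i} + k)
  exact (mul_le_mul_of_nonneg_right habove (orderStat_nonneg hr)).trans
    (card_filter_le_mul_le_sum (fun i _ => hr i) t)

end OrderStatistics

section Nets

open Metric Module Set

lemma exists_mem_norm_sub_le_of_isCover {V : Type*} [SeminormedAddCommGroup V] {ε : ℝ≥0}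
    {A s : Set V} (hs : IsCover ε A s) {u : V} (hu : u ∈ A) : ∃ c ∈ s, ‖u - c‖ ≤ ε := by
  obtain ⟨c, hc, huc : edist u c ≤ ε⟩ := hs hu
  refine ⟨c, hc, ?_⟩
  rwa [edist_nndist, ENNReal.coe_le_coe, ← NNReal.coe_le_coe, coe_nndist, dist_eq_norm] at huc

lemma packingNumber_ne_top_of_totallyBounded {X : Type*} [PseudoEMetricSpace X] {A : Set X}
    (hA : TotallyBounded A) {ε : ℝ≥0} (hε : ε ≠ 0) : packingNumber ε A ≠ ⊤ := by
  obtain ⟨N, -, hN, hcover⟩ := exists_finite_isCover_of_totallyBounded (ε := ε / 2) (by simpa) hA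
  rw [← mul_div_cancel₀ ε two_ne_zero]
  exact (((packingNumber_two_mul_le_externalCoveringNumber _ _).trans
    hcover.externalCoveringNumber_le_encard).trans_lt hN.encard_lt_top).ne

variable {E : Type*} [NormedAddCommGroup E] [NormedSpace ℝ E]

lemma card_le_of_isSeparated_of_subset_closedBall [FiniteDimensional ℝ E] {R ε : ℝ≥0} (hε : 0 < ε)
    {x : E} {s : Finset E} (hsep : IsSeparated ε (s : Set E)) (hs : (s : Set E) ⊆ closedBall x R) :
    (s.card : ℝ) ≤ (1 + 2 * R / ε) ^ finrank ℝ E := by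
  borelize E
  let μ : Measure E := Measure.addHaar
  have hδ : 0 < (ε : ℝ) / 2 := by positivity
  have hρ : 0 < (R : ℝ) + ε / 2 := by positivity
  have hdisj : (s : Set E).Pairwise (Function.onFun Disjoint fun c => ball c ((ε : ℝ) / 2)) := by
    intro c hc d hd hcd
    refine ball_disjoint_ball ?_
    have hlt : (ε : ℝ≥0∞) < edist c d := hsep hc hd hcd
    rw [edist_nndist, ENNReal.coe_lt_coe] at hlt
    rw [add_halves]
    exact_mod_cast hlt.le
  have hsub : (⋃ c ∈ s, ball c ((ε : ℝ) / 2)) ⊆ ball x (R + ε / 2) :=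
    iUnion₂_subset fun c hc => ball_subset_ball' <| by
      linarith [mem_closedBall.1 (hs hc)]
  have hvolume : (s.card : ℝ≥0∞) * ENNReal.ofReal ((ε / 2 : ℝ) ^ finrank ℝ E) * μ (ball 0 1) ≤
      ENNReal.ofReal ((R + ε / 2 : ℝ) ^ finrank ℝ E) * μ (ball 0 1) :=
    calc _ = μ (⋃ c ∈ s, ball c ((ε : ℝ) / 2)) := by
          rw [measure_biUnion_finset hdisj fun _ _ => measurableSet_ball]
          simp only [μ.addHaar_ball_of_pos _ hδ, Finset.sum_const, nsmul_eq_mul, mul_assoc]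
      _ ≤ μ (ball x (R + ε / 2)) := measure_mono hsub
      _ = _ := μ.addHaar_ball_of_pos _ hρ
  have hcard := ENNReal.toReal_le_of_le_ofReal (by positivity) <|
    (ENNReal.mul_le_mul_iff_left (measure_ball_pos μ _ zero_lt_one).ne' measure_ball_lt_top.ne).1
      hvolume
  rw [ENNReal.toReal_mul, ENNReal.toReal_natCast, ENNReal.toReal_ofReal (by positivity)] at hcard
  have hratio : 1 + 2 * (R : ℝ) / ε = (R + ε / 2) / (ε / 2) := by field_simp; ring
  rwa [hratio, div_pow, le_div_iff₀ (by positivity)]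

lemma exists_finset_isCover_card_le [FiniteDimensional ℝ E] {R ε : ℝ≥0} (hε : 0 < ε) {x : E}
    {A : Set E} (hA : A ⊆ closedBall x R) :
    ∃ s : Finset E, (s : Set E) ⊆ A ∧ IsCover ε A s ∧
      (s.card : ℝ) ≤ (1 + 2 * R / ε) ^ finrank ℝ E := by
  have hpack : packingNumber ε A ≠ ⊤ := packingNumber_ne_top_of_totallyBounded
    ((isCompact_closedBall x (R : ℝ)).totallyBounded.subset hA) hε.ne'
  obtain ⟨s, hs⟩ : ∃ s : Finset E, (s : Set E) = maximalSeparatedSet ε A :=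
    (encard_ne_top_iff.1 (by rwa [encard_maximalSeparatedSet hpack])).exists_finset_coe
  have hsA : (s : Set E) ⊆ A := hs ▸ maximalSeparatedSet_subset
  exact ⟨s, hsA, hs ▸ isCover_maximalSeparatedSet hpack,
    card_le_of_isSeparated_of_subset_closedBall hε (hs ▸ isSeparated_maximalSeparatedSet)
      (hsA.trans hA)⟩

lemma opNorm_le_div_of_isCover {F : Type*} [SeminormedAddCommGroup F] [NormedSpace ℝ F]
    (L : E →L[ℝ] F) {ε : ℝ≥0} {s : Set E} (hs : IsCover ε (sphere 0 1) s) (hε : ε < 1)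
    {B : ℝ} (hB : 0 ≤ B) (hL : ∀ c ∈ s, ‖L c‖ ≤ B) : ‖L‖ ≤ B / (1 - ε) := by
  have hε' : 0 < 1 - (ε : ℝ) := sub_pos.2 (by exact_mod_cast hε)
  suffices ‖L‖ ≤ B + ‖L‖ * ε by rw [le_div_iff₀ hε']; linarith
  refine L.opNorm_le_of_unit_norm (by positivity) fun u hu => ?_
  obtain ⟨c, hc, huc⟩ := exists_mem_norm_sub_le_of_isCover hs (mem_sphere_zero_iff_norm.2 hu)
  calc ‖L u‖ = ‖L c + L (u - c)‖ := by rw [← map_add, add_sub_cancel]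
    _ ≤ ‖L c‖ + ‖L (u - c)‖ := norm_add_le _ _
    _ ≤ B + ‖L‖ * ε := add_le_add (hL c hc) (L.le_opNorm_of_le huc)

end Nets

section Chernoff

open Real

lemma exp_le_one_add_add_sq_mul_exp_abs (y : ℝ) : exp y ≤ 1 + y + y ^ 2 * exp |y| := by
  have hremainder := Complex.norm_exp_sub_sum_le_norm_mul_exp (y : ℂ) 2
  have hcast : Complex.exp (y : ℂ) - ∑ i ∈ Finset.range 2, (y : ℂ) ^ i / (i.factorial : ℂ) =
      ((exp y - (1 + y) : ℝ) : ℂ) := by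
    simp [Finset.sum_range_succ]
  rw [hcast, Complex.norm_real, Complex.norm_real, norm_eq_abs, norm_eq_abs, sq_abs] at hremainder
  linarith [le_abs_self (exp y - (1 + y))]

lemma exp_mul_le_of_le_half {l₀ l : ℝ} (hl₀ : 0 < l₀) (hl : 0 ≤ l) (hll₀ : l ≤ l₀ / 2) (y : ℝ) :
    exp (l * y) ≤ 1 + l * y + 8 * l ^ 2 / l₀ ^ 2 * exp (l₀ * |y|) := by
  refine (exp_le_one_add_add_sq_mul_exp_abs (l * y)).trans ?_
  set z := l₀ / 2 * |y| with hz
  have hz0 : 0 ≤ z := by positivity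
  have hsq : z ^ 2 ≤ 2 * exp z := by linarith [quadratic_le_exp_of_nonneg hz0]
  have hexp : exp |l * y| ≤ exp z := by rw [abs_mul, abs_of_nonneg hl, hz]; gcongr
  gcongr 1 + l * y + ?_
  calc (l * y) ^ 2 * exp |l * y| = 4 * l ^ 2 / l₀ ^ 2 * z ^ 2 * exp |l * y| := by
        rw [hz, mul_pow, mul_pow, sq_abs]
        field_simp
        ring
    _ ≤ 4 * l ^ 2 / l₀ ^ 2 * (2 * exp z) * exp z := by gcongr
    _ = 8 * l ^ 2 / l₀ ^ 2 * (exp z * exp z) := by ring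
    _ = 8 * l ^ 2 / l₀ ^ 2 * exp (l₀ * |y|) := by rw [← exp_add, hz]; ring_nf

/-- The exponential moment condition `𝔼 exp (l₀ |f|) ≤ K` defining sub-exponential variables. -/
structure HasExpMoment {α : Type*} [MeasurableSpace α] (f : α → ℝ) (l₀ K : ℝ) (ν : Measure α) :
    Prop where
  measurable : Measurable f
  integrable_exp : Integrable (fun y => exp (l₀ * |f y|)) ν
  integral_exp_le : ∫ y, exp (l₀ * |f y|) ∂ν ≤ K

/-- The exponential rate of the Chernoff bound for a deviation `t` of the mean of independent
copies of a variable with `𝔼 exp (l₀ |f|) ≤ K`: half of `l * t`, where `l` is the minimizer of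
`8 * l ^ 2 / l₀ ^ 2 * K - l * t` truncated at `l₀ / 2`. -/
noncomputable def chernoffRate (l₀ K t : ℝ) : ℝ :=
  min (l₀ / 2) (t * l₀ ^ 2 / (16 * K)) * t / 2

section Rate

variable {l₀ K t : ℝ} (hl₀ : 0 < l₀) (hK : 0 < K) (ht : 0 < t)
include hl₀ hK ht

lemma chernoffRate_pos : 0 < chernoffRate l₀ K t := by
  have := lt_min (half_pos hl₀) (show 0 < t * l₀ ^ 2 / (16 * K) by positivity)
  rw [chernoffRate]
  positivity

lemma exists_chernoffRate_le :
    ∃ l, 0 ≤ l ∧ l ≤ l₀ / 2 ∧ chernoffRate l₀ K t ≤ l * t - 8 * l ^ 2 / l₀ ^ 2 * K := by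
  refine ⟨min (l₀ / 2) (t * l₀ ^ 2 / (16 * K)), by positivity, min_le_left _ _, ?_⟩
  rw [chernoffRate]
  set l := min (l₀ / 2) (t * l₀ ^ 2 / (16 * K))
  have hl : 0 ≤ l := by positivity
  have hlK : l * (16 * K) ≤ t * l₀ ^ 2 := (le_div_iff₀ (by positivity)).1 (min_le_right _ _)
  have hquad : 8 * l ^ 2 / l₀ ^ 2 * K ≤ l * t / 2 := by
    rw [div_mul_eq_mul_div, div_le_iff₀ (by positivity)]
    linarith [mul_le_mul_of_nonneg_left hlK hl]
  linarith

end Rate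

namespace HasExpMoment

variable {α : Type*} [MeasurableSpace α] {ν : Measure α} {f : α → ℝ} {l₀ K l : ℝ}

lemma neg (hf : HasExpMoment f l₀ K ν) : HasExpMoment (fun y => -f y) l₀ K ν where
  measurable := hf.measurable.neg
  integrable_exp := by simpa only [abs_neg] using hf.integrable_exp
  integral_exp_le := by simpa only [abs_neg] using hf.integral_exp_le

lemma abs (hf : HasExpMoment f l₀ K ν) : HasExpMoment (fun y => |f y|) l₀ K ν where
  measurable := hf.measurable.abs
  integrable_exp := by simpa only [abs_abs] using hf.integrable_exp
  integral_exp_le := by simpa only [abs_abs] using hf.integral_exp_le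

lemma of_abs_le_one [IsProbabilityMeasure ν] (hf : Measurable f) (hf1 : ∀ y, |f y| ≤ 1)
    (hl₀ : 0 ≤ l₀) : HasExpMoment f l₀ (exp l₀) ν := by
  have hle : ∀ y, exp (l₀ * |f y|) ≤ exp l₀ := fun y =>
    exp_le_exp.2 (mul_le_of_le_one_right hl₀ (hf1 y))
  have hint : Integrable (fun y => exp (l₀ * |f y|)) ν :=
    .of_bound (by fun_prop) (exp l₀) <| ae_of_all _ fun y => by
      simpa only [norm_eq_abs, abs_exp] using hle y
  exact ⟨hf, hint, (integral_mono hint (integrable_const _) hle).trans_eq (by simp)⟩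

lemma mono (hf : HasExpMoment f l₀ K ν) {K' : ℝ} (hK : K ≤ K') : HasExpMoment f l₀ K' ν :=
  ⟨hf.measurable, hf.integrable_exp, hf.integral_exp_le.trans hK⟩

lemma integrable (hf : HasExpMoment f l₀ K ν) (hl₀ : 0 < l₀) : Integrable f ν := by
  refine (hf.integrable_exp.const_mul l₀⁻¹).mono' hf.measurable.aestronglyMeasurable
    (ae_of_all _ fun y => ?_)
  rw [norm_eq_abs, ← div_eq_inv_mul, le_div_iff₀ hl₀, mul_comm]
  linarith [add_one_le_exp (l₀ * |f y|)]

lemma integrable_exp_mul (hf : HasExpMoment f l₀ K ν) (hl : |l| ≤ l₀) :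
    Integrable (fun y => exp (l * f y)) ν := by
  have hm := hf.measurable
  refine hf.integrable_exp.mono' (by fun_prop) (ae_of_all _ fun y => ?_)
  rw [norm_eq_abs, abs_exp, exp_le_exp]
  exact (le_abs_self _).trans (by rw [abs_mul]; gcongr)

lemma mgf_le [IsProbabilityMeasure ν] (hf : HasExpMoment f l₀ K ν) (hl₀ : 0 < l₀) (hl : 0 ≤ l)
    (hll₀ : l ≤ l₀ / 2) : mgf f ν l ≤ exp (l * ∫ y, f y ∂ν + 8 * l ^ 2 / l₀ ^ 2 * K) := by
  have hlin : Integrable (fun y => 1 + l * f y) ν :=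
    (integrable_const _).add ((hf.integrable hl₀).const_mul l)
  have hrem := hf.integrable_exp.const_mul (8 * l ^ 2 / l₀ ^ 2)
  calc mgf f ν l ≤ ∫ y, (1 + l * f y + 8 * l ^ 2 / l₀ ^ 2 * exp (l₀ * |f y|)) ∂ν :=
        integral_mono (hf.integrable_exp_mul (by rw [abs_of_nonneg hl]; linarith)) (hlin.add hrem)
          fun y => exp_mul_le_of_le_half hl₀ hl hll₀ (f y)
    _ = 1 + l * ∫ y, f y ∂ν + 8 * l ^ 2 / l₀ ^ 2 * ∫ y, exp (l₀ * |f y|) ∂ν := by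
        rw [integral_add hlin hrem,
          integral_add (integrable_const _) ((hf.integrable hl₀).const_mul l),
          integral_const_mul, integral_const_mul, integral_const, probReal_univ, one_smul]
    _ ≤ l * ∫ y, f y ∂ν + 8 * l ^ 2 / l₀ ^ 2 * K + 1 := by
        have := mul_le_mul_of_nonneg_left hf.integral_exp_le
          (show 0 ≤ 8 * l ^ 2 / l₀ ^ 2 by positivity)
        linarith
    _ ≤ _ := add_one_le_exp _

variable {Ω ι : Type*} [MeasurableSpace Ω] {μ : Measure Ω} [IsProbabilityMeasure μ]
  [IsProbabilityMeasure ν] {a : ι → Ω → α}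

/-- Only the number `M` of available samples enters the deviation and the probability, so that the
bound is uniform over the index sets `s`. -/
lemma measureReal_add_le_sum_le (hf : HasExpMoment f l₀ K ν) (ha : ∀ i, Measurable (a i))
    (hlaw : ∀ i, μ.map (a i) = ν) (hind : iIndepFun a μ) (hl₀ : 0 < l₀) (hK : 0 < K) {t M : ℝ}
    (ht : 0 < t) {s : Finset ι} (hs : (s.card : ℝ) ≤ M) :
    μ.real {ω | s.card * ∫ y, f y ∂ν + M * t ≤ ∑ i ∈ s, f (a i ω)} ≤
      exp (-(M * chernoffRate l₀ K t)) := by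
  obtain ⟨l, hl, hll₀, hrate⟩ := exists_chernoffRate_le hl₀ hK ht
  have hind' : iIndepFun (fun i ω => f (a i ω)) μ := hind.comp (fun _ => f) fun _ => hf.measurable
  have hmeas : ∀ i, Measurable fun ω => f (a i ω) := fun i => hf.measurable.comp (ha i)
  have hint : ∀ i, Integrable (fun ω => exp (l * f (a i ω))) μ := fun i => by
    have hexp := hf.integrable_exp_mul (l := l) (by rw [abs_of_nonneg hl]; linarith)
    rw [← hlaw i] at hexp
    exact hexp.comp_measurable (ha i)
  have hmgf : ∀ i, mgf (fun ω => f (a i ω)) μ l = mgf f ν l := fun i => by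
    have hfm := hf.measurable
    rw [← hlaw i, mgf_map (ha i).aemeasurable (by fun_prop)]
    rfl
  have hM : 0 ≤ M := s.card.cast_nonneg.trans hs
  have hchernoff := measure_ge_le_exp_mul_mgf (μ := μ) (X := ∑ i ∈ s, fun ω => f (a i ω))
    (s.card * ∫ y, f y ∂ν + M * t) hl (hind'.integrable_exp_mul_sum hmeas fun i _ => hint i)
  rw [hind'.mgf_sum hmeas, Finset.prod_congr rfl fun i _ => hmgf i, Finset.prod_const] at hchernoff
  simp only [Finset.sum_apply] at hchernoff
  calc _ ≤ exp (-l * (s.card * ∫ y, f y ∂ν + M * t)) * mgf f ν l ^ s.card := hchernoff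
    _ ≤ exp (-l * (s.card * ∫ y, f y ∂ν + M * t)) *
          exp (s.card * (l * ∫ y, f y ∂ν + 8 * l ^ 2 / l₀ ^ 2 * K)) := by
        rw [exp_nat_mul]
        gcongr
        exacts [mgf_nonneg, hf.mgf_le hl₀ hl hll₀]
    _ = exp (s.card * (8 * l ^ 2 / l₀ ^ 2 * K) - M * (l * t)) := by rw [← exp_add]; ring_nf
    _ ≤ exp (-(M * chernoffRate l₀ K t)) := by
        rw [exp_le_exp]
        have hvar := mul_le_mul_of_nonneg_right hs (show 0 ≤ 8 * l ^ 2 / l₀ ^ 2 * K by positivity)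
        linarith [mul_le_mul_of_nonneg_left hrate hM]

lemma measureReal_exists_add_le_sum_le {J : Type*} {f : J → α → ℝ} {S : Finset J}
    (hf : ∀ j ∈ S, HasExpMoment (f j) l₀ K ν) (ha : ∀ i, Measurable (a i))
    (hlaw : ∀ i, μ.map (a i) = ν) (hind : iIndepFun a μ) (hl₀ : 0 < l₀) (hK : 0 < K) {t M : ℝ}
    (ht : 0 < t) {s : Finset ι} (hs : (s.card : ℝ) ≤ M) :
    μ.real {ω | ∃ j ∈ S, s.card * ∫ y, f j y ∂ν + M * t ≤ ∑ i ∈ s, f j (a i ω)} ≤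
      S.card * exp (-(M * chernoffRate l₀ K t)) :=
  calc _ = μ.real (⋃ j ∈ S, {ω | s.card * ∫ y, f j y ∂ν + M * t ≤ ∑ i ∈ s, f j (a i ω)}) := by
        congr 1
        ext ω
        simp only [Set.mem_ofPred_eq, Set.mem_iUnion, exists_prop]
    _ ≤ ∑ _j ∈ S, exp (-(M * chernoffRate l₀ K t)) :=
        (measureReal_biUnion_finset_le _ _).trans <| Finset.sum_le_sum fun _ hj =>
          (hf _ hj).measureReal_add_le_sum_le ha hlaw hind hl₀ hK ht hs
    _ = _ := by rw [Finset.sum_const, nsmul_eq_mul]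

lemma measureReal_exists_sum_add_le_le {J : Type*} {f : J → α → ℝ} {S : Finset J}
    (hf : ∀ j ∈ S, HasExpMoment (f j) l₀ K ν) (ha : ∀ i, Measurable (a i))
    (hlaw : ∀ i, μ.map (a i) = ν) (hind : iIndepFun a μ) (hl₀ : 0 < l₀) (hK : 0 < K) {t M : ℝ}
    (ht : 0 < t) {s : Finset ι} (hs : (s.card : ℝ) ≤ M) :
    μ.real {ω | ∃ j ∈ S, ∑ i ∈ s, f j (a i ω) + M * t ≤ s.card * ∫ y, f j y ∂ν} ≤
      S.card * exp (-(M * chernoffRate l₀ K t)) := by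
  refine (congrArg μ.real ?_).trans_le <|
    measureReal_exists_add_le_sum_le (fun j hj => (hf j hj).neg) ha hlaw hind hl₀ hK ht hs
  ext ω
  refine exists_congr fun j => and_congr_right fun _ => ?_
  rw [integral_neg, Finset.sum_neg_distrib]
  constructor <;> intro h <;> linarith

end HasExpMoment

end Chernoff

section SubGaussian

open Real

lemma gaussianPDFReal_mul_exp_mul_sq (b x : ℝ) :
    gaussianPDFReal 0 1 x * exp (b * x ^ 2) = (√(2 * π))⁻¹ * exp (-(1 / 2 - b) * x ^ 2) := by
  rw [gaussianPDFReal, mul_assoc, ← exp_add, NNReal.coe_one]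
  ring_nf

lemma integrable_exp_mul_sq_gaussianReal {b : ℝ} (hb : b < 1 / 2) :
    Integrable (fun x => exp (b * x ^ 2)) (gaussianReal 0 1) := by
  rw [gaussianReal_of_var_ne_zero _ one_ne_zero]
  refine (integrable_withDensity_iff_integrable_smul₀' (by fun_prop)
    (ae_of_all _ fun _ => gaussianPDF_lt_top)).2 ?_
  simp only [toReal_gaussianPDF, smul_eq_mul, gaussianPDFReal_mul_exp_mul_sq]
  exact (integrable_exp_neg_mul_sq (sub_pos.2 hb)).const_mul _

lemma integral_exp_mul_sq_gaussianReal {b : ℝ} (hb : b < 1 / 2) :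
    ∫ x, exp (b * x ^ 2) ∂(gaussianReal 0 1) = (√(1 - 2 * b))⁻¹ := by
  have hpos : 0 < 1 - 2 * b := by linarith
  simp only [integral_gaussianReal_eq_integral_smul one_ne_zero, smul_eq_mul,
    gaussianPDFReal_mul_exp_mul_sq, integral_const_mul, integral_gaussian]
  rw [← sqrt_inv, ← sqrt_inv, ← sqrt_mul (by positivity)]
  congr 1
  have := pi_pos
  field_simp [show 1 / 2 - b ≠ 0 by linarith]

variable {α : Type*} [MeasurableSpace α] {ν : Measure α} {X Y : α → ℝ} {c : ℝ≥0} {l : ℝ}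

/- Gaussian linearization: `exp (l x²)` is the moment generating function of a standard Gaussian
at `√(2 l) x`, which makes the exponent linear in `X`. -/
lemma lintegral_exp_mul_sq_le [SFinite ν] (h : HasSubgaussianMGF X c ν) (hX : Measurable X)
    (hl : 0 ≤ l) (hcl : c * l < 1 / 2) :
    ∫⁻ y, ENNReal.ofReal (exp (l * X y ^ 2)) ∂ν ≤
      ENNReal.ofReal (√(1 - 2 * (c * l)))⁻¹ := by
  have hsq : √(2 * l) ^ 2 = 2 * l := sq_sqrt (by positivity)
  have hlinear (x : ℝ) : ENNReal.ofReal (exp (l * x ^ 2)) =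
      ∫⁻ g, ENNReal.ofReal (exp (√(2 * l) * x * g)) ∂(gaussianReal 0 1) := by
    rw [← ofReal_integral_eq_lintegral_ofReal (integrable_exp_mul_gaussianReal _)
      (ae_of_all _ fun _ => (exp_pos _).le)]
    have hmgf := mgf_gaussianReal (p := gaussianReal 0 1) (X := id) Measure.map_id (√(2 * l) * x)
    simp only [mgf, id] at hmgf
    rw [hmgf, mul_pow, hsq, NNReal.coe_one]
    ring_nf
  have hmgf_le (g : ℝ) : ∫⁻ y, ENNReal.ofReal (exp (√(2 * l) * X y * g)) ∂ν ≤
      ENNReal.ofReal (exp (c * l * g ^ 2)) := by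
    simp only [mul_right_comm _ _ g]
    rw [← ofReal_integral_eq_lintegral_ofReal (h.integrable_exp_mul _)
      (ae_of_all _ fun _ => (exp_pos _).le)]
    refine ENNReal.ofReal_le_ofReal ((h.mgf_le _).trans_eq ?_)
    rw [mul_pow, hsq]
    ring_nf
  simp only [hlinear]
  rw [lintegral_lintegral_swap (by fun_prop)]
  refine (lintegral_mono hmgf_le).trans_eq ?_
  rw [← integral_exp_mul_sq_gaussianReal hcl,
    ofReal_integral_eq_lintegral_ofReal (integrable_exp_mul_sq_gaussianReal hcl)
      (ae_of_all _ fun _ => (exp_pos _).le)]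

lemma integrable_exp_mul_sq [SFinite ν] (h : HasSubgaussianMGF X c ν) (hX : Measurable X)
    (hl : 0 ≤ l) (hcl : c * l < 1 / 2) : Integrable (fun y => exp (l * X y ^ 2)) ν :=
  (lintegral_ofReal_ne_top_iff_integrable (by fun_prop) (ae_of_all _ fun _ => (exp_pos _).le)).1
    ((lintegral_exp_mul_sq_le h hX hl hcl).trans_lt ENNReal.ofReal_lt_top).ne

lemma integral_exp_mul_sq_le [SFinite ν] (h : HasSubgaussianMGF X c ν) (hX : Measurable X)
    (hl : 0 ≤ l) (hcl : c * l < 1 / 2) :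
    ∫ y, exp (l * X y ^ 2) ∂ν ≤ (√(1 - 2 * (c * l)))⁻¹ := by
  rw [← ENNReal.ofReal_le_ofReal_iff (by positivity),
    ofReal_integral_eq_lintegral_ofReal (integrable_exp_mul_sq h hX hl hcl)
      (ae_of_all _ fun _ => (exp_pos _).le)]
  exact lintegral_exp_mul_sq_le h hX hl hcl

lemma exp_mul_abs_mul_le (hl : 0 ≤ l) (x y : ℝ) :
    exp (l * |x * y|) ≤ 1 / 2 * exp (l * x ^ 2) + 1 / 2 * exp (l * y ^ 2) := by
  have hmul : |x * y| ≤ 1 / 2 * x ^ 2 + 1 / 2 * y ^ 2 := by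
    rw [abs_mul]
    linarith [two_mul_le_add_sq |x| |y|, sq_abs x, sq_abs y]
  calc exp (l * |x * y|) ≤ exp (1 / 2 * (l * x ^ 2) + 1 / 2 * (l * y ^ 2)) := by
        rw [exp_le_exp]
        linarith [mul_le_mul_of_nonneg_left hmul hl]
    _ ≤ _ := convexOn_exp.2 trivial trivial (by norm_num) (by norm_num) (by norm_num)

lemma hasExpMoment_mul [SFinite ν] (h : HasSubgaussianMGF X c ν) (h' : HasSubgaussianMGF Y c ν)
    (hX : Measurable X) (hY : Measurable Y) (hl : 0 ≤ l) (hcl : c * l < 1 / 2) :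
    HasExpMoment (fun y => X y * Y y) l (√(1 - 2 * (c * l)))⁻¹ ν := by
  have hbound : Integrable (fun y => 1 / 2 * exp (l * X y ^ 2) + 1 / 2 * exp (l * Y y ^ 2)) ν :=
    ((integrable_exp_mul_sq h hX hl hcl).const_mul _).add
      ((integrable_exp_mul_sq h' hY hl hcl).const_mul _)
  have hint : Integrable (fun y => exp (l * |X y * Y y|)) ν :=
    hbound.mono' (by fun_prop) <| ae_of_all _ fun y => by
      simpa only [norm_eq_abs, abs_exp] using exp_mul_abs_mul_le hl (X y) (Y y)
  refine ⟨by fun_prop, hint,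
    (integral_mono hint hbound fun y => exp_mul_abs_mul_le hl (X y) (Y y)).trans ?_⟩
  rw [integral_add ((integrable_exp_mul_sq h hX hl hcl).const_mul _)
    ((integrable_exp_mul_sq h' hY hl hcl).const_mul _), integral_const_mul, integral_const_mul]
  linarith [integral_exp_mul_sq_le h hX hl hcl, integral_exp_mul_sq_le h' hY hl hcl]

end SubGaussian

section Law

lemma integral_eq_zero_of_hasSubgaussianMGF {α : Type*} [MeasurableSpace α] {ν : Measure α}
    [IsProbabilityMeasure ν] {X : α → ℝ} {c : ℝ≥0} (h : HasSubgaussianMGF X c ν) :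
    ∫ y, X y ∂ν = 0 := by
  have hmem : (0 : ℝ) ∈ interior (integrableExpSet X ν) := by simp [h.integrableExpSet_eq_univ]
  have hmin : IsLocalMin (fun t => c * t ^ 2 / 2 - cgf X ν t) 0 := .of_forall fun t => by
    simpa using h.cgf_le t
  have hcgf := (analyticAt_cgf hmem).differentiableAt.hasDerivAt
  rw [deriv_cgf_zero hmem, probReal_univ, div_one] at hcgf
  have hderiv := ((((hasDerivAt_id (0 : ℝ)).pow 2).const_mul (c : ℝ)).div_const 2).sub hcgf
  simpa using hmin.hasDerivAt_eq_zero hderiv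

/-- The moments of a law `ν` that enter the proof. The products `⟨y, u⟩ ⟨y, v⟩` of unit vectors
are uniformly sub-exponential, with first absolute moment in `[κst, S]`, and both factors are at
least `κ` in absolute value with probability at least `p₀`. -/
structure HasProductMoments {E : Type*} [NormedAddCommGroup E] [InnerProductSpace ℝ E]
    [MeasurableSpace E] (ν : Measure E) (l₀ K S κst κ p₀ : ℝ) : Prop where
  hasExpMoment : ∀ u v, ‖u‖ = 1 → ‖v‖ = 1 → HasExpMoment (fun y => ⟪y, u⟫ * ⟪y, v⟫) l₀ K ν
  integral_le : ∀ u v, ‖u‖ = 1 → ‖v‖ = 1 → ∫ y, |⟪y, u⟫ * ⟪y, v⟫| ∂ν ≤ S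
  le_integral : ∀ u v, ‖u‖ = 1 → ‖v‖ = 1 → κst ≤ ∫ y, |⟪y, u⟫ * ⟪y, v⟫| ∂ν
  le_measureReal : ∀ u v, ‖u‖ = 1 → ‖v‖ = 1 → p₀ ≤ ν.real {y | κ ≤ min |⟪y, u⟫| |⟪y, v⟫|}

lemma HasProductMoments.mono {E : Type*} [NormedAddCommGroup E] [InnerProductSpace ℝ E]
    [MeasurableSpace E] {ν : Measure E} {l₀ K S κst κ p₀ S' κst' p₀' : ℝ}
    (h : HasProductMoments ν l₀ K S κst κ p₀) (hS : S ≤ S') (hκst : κst' ≤ κst) (hp₀ : p₀' ≤ p₀) :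
    HasProductMoments ν l₀ K S' κst' κ p₀' where
  hasExpMoment := h.hasExpMoment
  integral_le u v hu hv := (h.integral_le u v hu hv).trans hS
  le_integral u v hu hv := hκst.trans (h.le_integral u v hu hv)
  le_measureReal u v hu hv := hp₀.trans (h.le_measureReal u v hu hv)

lemma iInf_iInf_le_of_nonneg {α β : Type*} {f : α → β → ℝ} (hf : ∀ a b, 0 ≤ f a b) (a : α)
    (b : β) : ⨅ a, ⨅ b, f a b ≤ f a b :=
  (ciInf_le ⟨0, Set.forall_mem_range.2 fun a => Real.iInf_nonneg (hf a)⟩ a).trans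
    (ciInf_le ⟨0, Set.forall_mem_range.2 (hf a)⟩ b)

variable {n : ℕ} {ν : Measure (EuclideanSpace ℝ (Fin n))} {σ : ℝ≥0} {κ : ℝ}
  {u v : EuclideanSpace ℝ (Fin n)}

lemma kappaSt_le (hu : ‖u‖ = 1) (hv : ‖v‖ = 1) :
    kappaSt ν ≤ ∫ y, |⟪y, u⟫ * ⟪y, v⟫| ∂ν :=
  iInf_iInf_le_of_nonneg (f := fun u v : Metric.sphere (0 : EuclideanSpace ℝ (Fin n)) 1 =>
      ∫ y, |⟪y, (u : EuclideanSpace ℝ (Fin n))⟫ * ⟪y, (v : EuclideanSpace ℝ (Fin n))⟫| ∂ν)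
    (fun _ _ => integral_nonneg fun _ => abs_nonneg _)
    ⟨u, mem_sphere_zero_iff_norm.2 hu⟩ ⟨v, mem_sphere_zero_iff_norm.2 hv⟩

lemma smallBallProb_le (hu : ‖u‖ = 1) (hv : ‖v‖ = 1) :
    smallBallProb ν κ ≤ ν.real {y | κ ≤ min |⟪y, u⟫| |⟪y, v⟫|} :=
  iInf_iInf_le_of_nonneg (f := fun u v : Metric.sphere (0 : EuclideanSpace ℝ (Fin n)) 1 =>
      ν.real {y | κ ≤ min |⟪y, (u : EuclideanSpace ℝ (Fin n))⟫|
        |⟪y, (v : EuclideanSpace ℝ (Fin n))⟫|})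
    (fun _ _ => measureReal_nonneg)
    ⟨u, mem_sphere_zero_iff_norm.2 hu⟩ ⟨v, mem_sphere_zero_iff_norm.2 hv⟩

lemma smallBallProb_nonneg : 0 ≤ smallBallProb ν κ :=
  Real.iInf_nonneg fun _ => Real.iInf_nonneg fun _ => measureReal_nonneg

lemma variance_inner [IsFiniteMeasure ν]
    (hν : ∀ i, MemLp (fun y : EuclideanSpace ℝ (Fin n) => y i) 2 ν)
    (u : EuclideanSpace ℝ (Fin n)) :
    variance (fun y => ⟪u, y⟫) ν =
      ⟪u, Matrix.toEuclideanCLM (n := Fin n) (𝕜 := ℝ) (covarianceMatrix ν) u⟫ := by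
  have hinner : (fun y : EuclideanSpace ℝ (Fin n) => ⟪u, y⟫) = fun y => ∑ i, u i * y i := by
    ext y
    simp [PiLp.inner_apply, mul_comm]
  rw [← covariance_self (by fun_prop), hinner,
    covariance_fun_sum_fun_sum (fun i => (hν i).const_mul _) fun i => (hν i).const_mul _,
    Matrix.inner_toEuclideanCLM]
  simp only [covariance_const_mul_left, covariance_const_mul_right, dotProduct, Matrix.mulVec,
    covarianceMatrix, Matrix.of_apply, Finset.mul_sum]
  exact Finset.sum_congr rfl fun i _ => Finset.sum_congr rfl fun j _ => by ring

lemma variance_inner_le [IsFiniteMeasure ν]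
    (hν : ∀ i, MemLp (fun y : EuclideanSpace ℝ (Fin n) => y i) 2 ν)
    (u : EuclideanSpace ℝ (Fin n)) :
    variance (fun y => ⟪u, y⟫) ν ≤ specNorm (covarianceMatrix ν) * ‖u‖ ^ 2 := by
  rw [variance_inner hν]
  refine (real_inner_le_norm _ _).trans ?_
  have := mul_le_mul_of_nonneg_left ((Matrix.toEuclideanCLM (n := Fin n) (𝕜 := ℝ)
    (covarianceMatrix ν)).le_opNorm u) (norm_nonneg u)
  rw [specNorm]
  linarith

namespace IsSubGaussian

variable (hν : IsSubGaussian ν σ)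
include hν

lemma hasSubgaussianMGF_inner (hu : ‖u‖ = 1) : HasSubgaussianMGF (fun y => ⟪y, u⟫) (σ ^ 2) ν := by
  simpa only [show ‖u‖₊ = 1 from NNReal.eq hu, one_pow, mul_one, real_inner_comm] using hν u

lemma memLp_inner (u : EuclideanSpace ℝ (Fin n)) : MemLp (fun y => ⟪y, u⟫) 2 ν := by
  simpa only [real_inner_comm, ENNReal.coe_ofNat] using (hν u).memLp 2

variable [IsProbabilityMeasure ν]

lemma integral_inner_sq_le (hu : ‖u‖ = 1) :
    ∫ y, ⟪y, u⟫ ^ 2 ∂ν ≤ specNorm (covarianceMatrix ν) := by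
  have hcoord (i : Fin n) : MemLp (fun y : EuclideanSpace ℝ (Fin n) => y i) 2 ν := by
    simpa [EuclideanSpace.inner_single_right] using hν.memLp_inner (EuclideanSpace.single i 1)
  have hmean := integral_eq_zero_of_hasSubgaussianMGF (hν u)
  simpa only [variance_of_integral_eq_zero (hν u).aemeasurable hmean, hu, one_pow, mul_one,
    real_inner_comm] using variance_inner_le hcoord u

lemma integral_abs_inner_mul_inner_le (hu : ‖u‖ = 1) (hv : ‖v‖ = 1) :
    ∫ y, |⟪y, u⟫ * ⟪y, v⟫| ∂ν ≤ specNorm (covarianceMatrix ν) := by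
  have hint (w : EuclideanSpace ℝ (Fin n)) : Integrable (fun y => ⟪y, w⟫ ^ 2 / 2) ν :=
    (hν.memLp_inner w).integrable_sq.div_const 2
  calc ∫ y, |⟪y, u⟫ * ⟪y, v⟫| ∂ν ≤ ∫ y, (⟪y, u⟫ ^ 2 / 2 + ⟪y, v⟫ ^ 2 / 2) ∂ν := by
        refine integral_mono ((hν.memLp_inner u).integrable_mul (hν.memLp_inner v)).abs
          ((hint u).add (hint v)) fun y => ?_
        simp only [abs_mul]
        linarith [two_mul_le_add_sq |⟪y, u⟫| |⟪y, v⟫|, sq_abs ⟪y, u⟫, sq_abs ⟪y, v⟫]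
    _ = (∫ y, ⟪y, u⟫ ^ 2 ∂ν) / 2 + (∫ y, ⟪y, v⟫ ^ 2 ∂ν) / 2 := by
        rw [integral_add (hint u) (hint v), integral_div, integral_div]
    _ ≤ specNorm (covarianceMatrix ν) := by
        linarith [hν.integral_inner_sq_le hu, hν.integral_inner_sq_le hv]

lemma hasExpMoment_inner_mul_inner (hu : ‖u‖ = 1) (hv : ‖v‖ = 1) :
    HasExpMoment (fun y => ⟪y, u⟫ * ⟪y, v⟫) (1 / (4 * ((σ : ℝ) ^ 2 + 1))) 2 ν := by
  have hrate : σ ^ 2 * (1 / (4 * ((σ : ℝ) ^ 2 + 1))) ≤ 1 / 4 := by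
    rw [mul_one_div, div_le_div_iff₀ (by positivity) (by norm_num)]
    linarith
  refine (hasExpMoment_mul (l := 1 / (4 * ((σ : ℝ) ^ 2 + 1))) (hν.hasSubgaussianMGF_inner hu)
    (hν.hasSubgaussianMGF_inner hv) (by fun_prop) (by fun_prop) (by positivity) ?_).mono ?_
  · push_cast
    linarith
  · push_cast
    rw [inv_le_comm₀ (Real.sqrt_pos.2 (by linarith)) two_pos]
    exact Real.le_sqrt_of_sq_le (by linarith)

lemma hasProductMoments : HasProductMoments ν (1 / (4 * ((σ : ℝ) ^ 2 + 1))) 2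
    (specNorm (covarianceMatrix ν)) (kappaSt ν) κ (smallBallProb ν κ) where
  hasExpMoment _ _ hu hv := hν.hasExpMoment_inner_mul_inner hu hv
  integral_le _ _ hu hv := hν.integral_abs_inner_mul_inner_le hu hv
  le_integral _ _ hu hv := kappaSt_le hu hv
  le_measureReal _ _ hu hv := smallBallProb_le hu hv

end IsSubGaussian

end Law

section Sampling

open Finset Metric

variable {E : Type*} [NormedAddCommGroup E] [InnerProductSpace ℝ E] {ι : Type*}

/-- The sum `∑ |⟨A i, u⟩ ⟨A i, v⟩|` over an index set `I`. At `u = x - x⋆` and `v = x + x⋆` its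
terms are the residuals `|⟨A i, x⟩² - ⟨A i, x⋆⟩²|` of exact measurements. -/
def absProductSum (A : ι → E) (I : Finset ι) (u v : E) : ℝ :=
  ∑ i ∈ I, |⟪A i, u⟫ * ⟪A i, v⟫|

lemma absProductSum_smul_smul (A : ι → E) (I : Finset ι) (u v : E) (a b : ℝ) :
    absProductSum A I (a • u) (b • v) = |a * b| * absProductSum A I u v := by
  simp only [absProductSum, mul_sum, inner_smul_right, ← abs_mul]
  exact sum_congr rfl fun i _ => by ring_nf

variable [Fintype ι]

/-- The sampling operator `u ↦ (⟨A i, u⟩)ᵢ` of a finite family of vectors; the square of its norm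
is the optimal Bessel bound of the family. -/
noncomputable def samplingOperator (A : ι → E) : E →L[ℝ] EuclideanSpace ℝ ι :=
  (PiLp.continuousLinearEquiv 2 ℝ fun _ : ι => ℝ).symm.toContinuousLinearMap.comp
    (ContinuousLinearMap.pi fun i => innerSL ℝ (A i))

variable (A : ι → E) (I : Finset ι) (u v : E)

lemma norm_samplingOperator_apply_sq : ‖samplingOperator A u‖ ^ 2 = ∑ i, ⟪A i, u⟫ ^ 2 := by
  simp [EuclideanSpace.norm_sq_eq, samplingOperator]

lemma sum_inner_sq_le : ∑ i ∈ I, ⟪A i, u⟫ ^ 2 ≤ ‖samplingOperator A‖ ^ 2 * ‖u‖ ^ 2 := by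
  refine (sum_le_univ_sum_of_nonneg fun _ => sq_nonneg _).trans ?_
  rw [← norm_samplingOperator_apply_sq, ← mul_pow]
  exact pow_le_pow_left₀ (norm_nonneg _) ((samplingOperator A).le_opNorm u) 2

lemma norm_samplingOperator_sq_le_of_isCover {ε : ℝ≥0} {s : Set E}
    (hs : IsCover ε (sphere 0 1) s) (hε : (ε : ℝ) ≤ 1 / 2) {B : ℝ} (hB : 0 ≤ B)
    (h : ∀ c ∈ s, ∑ i, ⟪A i, c⟫ ^ 2 ≤ B) : ‖samplingOperator A‖ ^ 2 ≤ 4 * B := by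
  have hε1 : ε < 1 := by exact_mod_cast hε.trans_lt one_half_lt_one
  have hnorm := opNorm_le_div_of_isCover (samplingOperator A) hs hε1 B.sqrt_nonneg fun c hc =>
    Real.le_sqrt_of_sq_le <| (norm_samplingOperator_apply_sq A c).trans_le (h c hc)
  have hhalf : √B / (1 - ε) ≤ 2 * √B := by
    rw [div_le_iff₀ (by linarith)]
    nlinarith [B.sqrt_nonneg]
  calc ‖samplingOperator A‖ ^ 2 ≤ (2 * √B) ^ 2 :=
        pow_le_pow_left₀ (norm_nonneg _) (hnorm.trans hhalf) 2
    _ = 4 * B := by rw [mul_pow, Real.sq_sqrt hB]; norm_num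

lemma absProductSum_le_univ : absProductSum A I u v ≤ absProductSum A univ u v :=
  sum_le_univ_sum_of_nonneg fun _ => abs_nonneg _

lemma absProductSum_le :
    absProductSum A I u v ≤ ‖samplingOperator A‖ ^ 2 * (‖u‖ * ‖v‖) := by
  refine le_of_sq_le_sq ?_ (by positivity)
  calc absProductSum A I u v ^ 2
      ≤ (∑ i ∈ I, ⟪A i, u⟫ ^ 2) * ∑ i ∈ I, ⟪A i, v⟫ ^ 2 := by
        simpa only [absProductSum, abs_mul, sq_abs] using
          sum_mul_sq_le_sq_mul_sq I (fun i => |⟪A i, u⟫|) fun i => |⟪A i, v⟫|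
    _ ≤ (‖samplingOperator A‖ ^ 2 * ‖u‖ ^ 2) * (‖samplingOperator A‖ ^ 2 * ‖v‖ ^ 2) :=
        mul_le_mul (sum_inner_sq_le A I u) (sum_inner_sq_le A I v)
          (sum_nonneg fun _ _ => sq_nonneg _) (by positivity)
    _ = _ := by ring

lemma abs_absProductSum_sub_le (u' v' : E) :
    |absProductSum A I u v - absProductSum A I u' v'| ≤
      ‖samplingOperator A‖ ^ 2 * (‖u - u'‖ * ‖v‖ + ‖u'‖ * ‖v - v'‖) := by
  rw [absProductSum, absProductSum, ← sum_sub_distrib]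
  calc |∑ i ∈ I, (|⟪A i, u⟫ * ⟪A i, v⟫| - |⟪A i, u'⟫ * ⟪A i, v'⟫|)|
      ≤ ∑ i ∈ I, |⟪A i, u⟫ * ⟪A i, v⟫ - ⟪A i, u'⟫ * ⟪A i, v'⟫| :=
        (abs_sum_le_sum_abs _ _).trans (sum_le_sum fun i _ => abs_abs_sub_abs_le _ _)
    _ ≤ ∑ i ∈ I, (|⟪A i, u - u'⟫ * ⟪A i, v⟫| + |⟪A i, u'⟫ * ⟪A i, v - v'⟫|) := by
        refine sum_le_sum fun i _ => (le_of_eq ?_).trans (abs_add_le _ _)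
        rw [inner_sub_right, inner_sub_right]
        ring_nf
    _ ≤ _ := by
        rw [sum_add_distrib, mul_add]
        exact add_le_add (absProductSum_le A I _ _) (absProductSum_le A I _ _)

lemma half_le_abs_of_sq_sub_lt {κ x y : ℝ} (hκ : 0 < κ) (hy : κ ≤ |y|)
    (hxy : (x - y) ^ 2 < (κ / 2) ^ 2) : κ / 2 ≤ |x| := by
  have := abs_lt_of_sq_lt_sq hxy (by positivity)
  linarith [abs_sub_abs_le_abs_sub y x, abs_sub_comm x y]

/- A clean small-ball index survives the perturbation unless `|⟨A i, u - u'⟩|` or `|⟨A i, v - v'⟩|`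
is at least `κ / 2`, which Markov's inequality and the Bessel bound make rare. -/
lemma card_le_min_abs_inner_le {κ : ℝ} (hκ : 0 < κ) (u' v' : E) :
    (#{i ∈ I | κ ≤ min |⟪A i, u'⟫| |⟪A i, v'⟫|} : ℝ) ≤
      #{i ∈ I | (κ / 2) ^ 2 ≤ |⟪A i, u⟫ * ⟪A i, v⟫|} +
        ‖samplingOperator A‖ ^ 2 * (‖u - u'‖ ^ 2 + ‖v - v'‖ ^ 2) / (κ / 2) ^ 2 := by
  classical
  have hlarge (w : E) : (#{i ∈ I | (κ / 2) ^ 2 ≤ ⟪A i, w⟫ ^ 2} : ℝ) ≤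
      ‖samplingOperator A‖ ^ 2 * ‖w‖ ^ 2 / (κ / 2) ^ 2 := by
    rw [le_div_iff₀ (by positivity)]
    exact (card_filter_le_mul_le_sum (fun i _ => sq_nonneg ⟪A i, w⟫) _).trans
      (sum_inner_sq_le A I w)
  have hsub : {i ∈ I | κ ≤ min |⟪A i, u'⟫| |⟪A i, v'⟫|} ⊆
      {i ∈ I | (κ / 2) ^ 2 ≤ |⟪A i, u⟫ * ⟪A i, v⟫|} ∪
        ({i ∈ I | (κ / 2) ^ 2 ≤ ⟪A i, u - u'⟫ ^ 2} ∪
          {i ∈ I | (κ / 2) ^ 2 ≤ ⟪A i, v - v'⟫ ^ 2}) := by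
    intro i
    simp only [mem_filter, mem_union, le_min_iff, inner_sub_right, abs_mul, sq (κ / 2)]
    rintro ⟨hi, hu', hv'⟩
    by_contra! hcon
    obtain ⟨hprod, hu, hv⟩ := hcon
    rw [← sq (κ / 2)] at hu hv
    exact (hprod hi).not_ge <| mul_le_mul (half_le_abs_of_sq_sub_lt hκ hu' (hu hi))
      (half_le_abs_of_sq_sub_lt hκ hv' (hv hi)) (by positivity) (abs_nonneg _)
  have hcard := (card_le_card hsub).trans <|
    (card_union_le _ _).trans (Nat.add_le_add_left (card_union_le _ _) _)
  rw [mul_add, add_div]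
  refine (Nat.cast_le.2 hcard).trans ?_
  push_cast
  linarith [hlarge (u - u'), hlarge (v - v')]

end Sampling

section UniformBounds

open Finset Metric

variable {E : Type*} [NormedAddCommGroup E] [InnerProductSpace ℝ E]
  {ι : Type*} [Fintype ι] [DecidableEq ι]
  {A : ι → E} {G : Finset ι} {S κst κ p₀ t g C h q : ℝ}

/-- The empirical sums over the clean indices `G` and the corrupted indices `Gᶜ`, in directions of
the net `s`, deviate from their expectations in the unfavourable direction by at most `t` per
sample. -/
structure NetEstimates (A : ι → E) (G : Finset ι) (S κst κ p₀ t : ℝ) (s : Finset E) : Prop where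
  clean : ∀ u ∈ s, ∀ v ∈ s, #G * κst - Fintype.card ι * t ≤ absProductSum A G u v
  corrupted : ∀ u ∈ s, ∀ v ∈ s, absProductSum A Gᶜ u v ≤ #Gᶜ * S + Fintype.card ι * t
  square : ∀ u ∈ s, ∑ i, ⟪A i, u⟫ ^ 2 ≤ Fintype.card ι * (S + t)
  smallBall : ∀ u ∈ s, ∀ v ∈ s,
    #G * p₀ - Fintype.card ι * t ≤ #{i ∈ G | κ ≤ min |⟪A i, u⟫| |⟪A i, v⟫|}

/-- The deterministic properties of a sample on which the comparison of quantile and objective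
rests; `sharp` is the sharpness of the robust objective and `count` says that more than a fraction
`q` of the indices are clean and have a large product. -/
structure UniformBounds (A : ι → E) (G : Finset ι) (g C h q : ℝ) : Prop where
  sharp : ∀ w z, Fintype.card ι * g * (‖w‖ * ‖z‖) + absProductSum A Gᶜ w z ≤ absProductSum A G w z
  upper : ∀ w z, absProductSum A univ w z ≤ Fintype.card ι * C * (‖w‖ * ‖z‖)
  count : ∀ w z,
    Fintype.card ι * q < #{i ∈ G | h * (‖w‖ * ‖z‖) ≤ |⟪A i, w⟫ * ⟪A i, z⟫|}

lemma exists_norm_eq_one_eq_norm_smul [Nontrivial E] (w : E) : ∃ u : E, ‖u‖ = 1 ∧ w = ‖w‖ • u := by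
  rcases eq_or_ne w 0 with rfl | hw
  · obtain ⟨u, hu⟩ := exists_norm_eq E zero_le_one
    exact ⟨u, hu, by simp⟩
  · exact ⟨‖w‖⁻¹ • w, norm_smul_inv_norm hw, (smul_inv_smul₀ (norm_ne_zero_iff.2 hw) w).symm⟩

lemma uniformBounds_of_norm_eq_one [Nontrivial E]
    (hsharp : ∀ u v, ‖u‖ = 1 → ‖v‖ = 1 →
      Fintype.card ι * g + absProductSum A Gᶜ u v ≤ absProductSum A G u v)
    (hupper : ‖samplingOperator A‖ ^ 2 ≤ Fintype.card ι * C)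
    (hcount : ∀ u v, ‖u‖ = 1 → ‖v‖ = 1 →
      Fintype.card ι * q < #{i ∈ G | h ≤ |⟪A i, u⟫ * ⟪A i, v⟫|}) :
    UniformBounds A G g C h q where
  sharp w z := by
    obtain ⟨u, hu, hwu⟩ := exists_norm_eq_one_eq_norm_smul w
    obtain ⟨v, hv, hzv⟩ := exists_norm_eq_one_eq_norm_smul z
    have hscale (I : Finset ι) : absProductSum A I w z = ‖w‖ * ‖z‖ * absProductSum A I u v := by
      conv_lhs => rw [hwu, hzv, absProductSum_smul_smul]
      rw [abs_of_nonneg (by positivity)]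
    rw [hscale, hscale, mul_comm, ← mul_add]
    exact mul_le_mul_of_nonneg_left (hsharp u v hu hv) (by positivity)
  upper w z := (absProductSum_le A univ w z).trans <| by gcongr
  count w z := by
    obtain ⟨u, hu, hwu⟩ := exists_norm_eq_one_eq_norm_smul w
    obtain ⟨v, hv, hzv⟩ := exists_norm_eq_one_eq_norm_smul z
    refine (hcount u v hu hv).trans_le (Nat.cast_le.2 (card_le_card ?_))
    refine monotone_filter_right G fun i _ hi => ?_
    have hprod : ⟪A i, w⟫ * ⟪A i, z⟫ = ‖w‖ * ‖z‖ * (⟪A i, u⟫ * ⟪A i, v⟫) := by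
      conv_lhs => rw [hwu, hzv, inner_smul_right, inner_smul_right]
      ring
    rw [hprod, abs_mul, abs_of_nonneg (by positivity : 0 ≤ ‖w‖ * ‖z‖), mul_comm h]
    exact mul_le_mul_of_nonneg_left hi (by positivity)

theorem NetEstimates.uniformBounds [Nontrivial E] {s : Finset E} {ε : ℝ≥0}
    (hnet : NetEstimates A G S κst κ p₀ t s) (hs : (s : Set E) ⊆ sphere 0 1)
    (hcover : IsCover ε (sphere 0 1) (s : Set E)) (hε : (ε : ℝ) ≤ 1 / 2) (hκ : 0 < κ)
    (hSt : 0 ≤ S + t) (hC : 4 * (S + t) ≤ C)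
    (hsharp : Fintype.card ι * (g + 2 * t + 4 * C * ε) ≤ #G * κst - #Gᶜ * S)
    (hcount : Fintype.card ι * (q + t + 2 * C * ε ^ 2 / (κ / 2) ^ 2) < #G * p₀) :
    UniformBounds A G g C ((κ / 2) ^ 2) q := by
  have hbessel : ‖samplingOperator A‖ ^ 2 ≤ Fintype.card ι * C := by
    have := norm_samplingOperator_sq_le_of_isCover A hcover hε
      (B := Fintype.card ι * (S + t)) (by positivity) hnet.square
    linarith [mul_le_mul_of_nonneg_left hC (Nat.cast_nonneg (α := ℝ) (Fintype.card ι))]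
  have hnear {u : E} (hu : ‖u‖ = 1) : ∃ c ∈ s, ‖c‖ = 1 ∧ ‖u - c‖ ≤ ε := by
    obtain ⟨c, hc, huc⟩ :=
      exists_mem_norm_sub_le_of_isCover hcover (mem_sphere_zero_iff_norm.2 hu)
    exact ⟨c, hc, mem_sphere_zero_iff_norm.1 (hs hc), huc⟩
  refine uniformBounds_of_norm_eq_one (fun u v hu hv => ?_) hbessel fun u v hu hv => ?_ <;>
    obtain ⟨u', hu's, hu', huu'⟩ := hnear hu <;> obtain ⟨v', hv's, -, hvv'⟩ := hnear hv
  · have hdiff (I : Finset ι) : |absProductSum A I u v - absProductSum A I u' v'| ≤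
        Fintype.card ι * C * (2 * ε) := by
      refine (abs_absProductSum_sub_le A I u v u' v').trans ?_
      rw [hu', hv]
      exact mul_le_mul hbessel (by linarith) (by positivity) ((sq_nonneg _).trans hbessel)
    linarith [(abs_le.1 (hdiff G)).1, (abs_le.1 (hdiff Gᶜ)).2, hnet.clean u' hu's v' hv's,
      hnet.corrupted u' hu's v' hv's]
  · have hlost : ‖samplingOperator A‖ ^ 2 * (‖u - u'‖ ^ 2 + ‖v - v'‖ ^ 2) / (κ / 2) ^ 2 ≤
        Fintype.card ι * C * (2 * ε ^ 2) / (κ / 2) ^ 2 := by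
      gcongr
      · exact (sq_nonneg _).trans hbessel
      · linarith [pow_le_pow_left₀ (norm_nonneg _) huu' 2, pow_le_pow_left₀ (norm_nonneg _) hvv' 2]
    have heq : (Fintype.card ι * C * (2 * ε ^ 2) / (κ / 2) ^ 2 : ℝ) =
        Fintype.card ι * (2 * C * ε ^ 2 / (κ / 2) ^ 2) := by ring
    linarith [card_le_min_abs_inner_le A G u v hκ u' v', hnet.smallBall u' hu's v' hv's]

end UniformBounds

section QuantileComparison

open Finset

lemma abs_inner_sub_mul_inner_add {E : Type*} [NormedAddCommGroup E] [InnerProductSpace ℝ E]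
    (a x y : E) : |⟪a, x - y⟫ * ⟪a, x + y⟫| = |⟪a, x⟫ ^ 2 - ⟪a, y⟫ ^ 2| := by
  rw [inner_sub_right, inner_add_right]
  ring_nf

variable {n m k : ℕ} {A : Fin m → EuclideanSpace ℝ (Fin n)} {G : Finset (Fin m)} {b : Fin m → ℝ}
  {xs : EuclideanSpace ℝ (Fin n)} {g C h q η p : ℝ}

lemma absResidual_eq_of_eq_sq {i : Fin m} (hb : b i = ⟪A i, xs⟫ ^ 2)
    (x : EuclideanSpace ℝ (Fin n)) :
    absResidual A b x i = |⟪A i, x - xs⟫ * ⟪A i, x + xs⟫| := by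
  rw [abs_inner_sub_mul_inner_add, ← hb, absResidual]

lemma abs_absResidual_sub_le (x y : EuclideanSpace ℝ (Fin n)) (i : Fin m) :
    |absResidual A b x i - absResidual A b y i| ≤ |⟪A i, x - y⟫ * ⟪A i, x + y⟫| := by
  rw [abs_inner_sub_mul_inner_add]
  refine (abs_abs_sub_abs_le _ _).trans_eq ?_
  rw [sub_sub_sub_cancel_right]

lemma mul_objective_sub_objective (x y : EuclideanSpace ℝ (Fin n)) :
    m * (objective A b x - objective A b y) =
      ∑ i, (absResidual A b x i - absResidual A b y i) := by
  rcases m.eq_zero_or_pos with rfl | hm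
  · simp
  · rw [objective, objective, sum_sub_distrib]
    field_simp

namespace UniformBounds

lemma mul_le_objective_sub (hU : UniformBounds A G g C h q) (hm : 0 < m)
    (hb : ∀ i ∈ G, b i = ⟪A i, xs⟫ ^ 2) (x : EuclideanSpace ℝ (Fin n)) :
    g * (‖x - xs‖ * ‖x + xs‖) ≤ objective A b x - objective A b xs := by
  refine le_of_mul_le_mul_left ?_ (Nat.cast_pos.2 hm : (0 : ℝ) < m)
  have hclean : ∑ i ∈ G, (absResidual A b x i - absResidual A b xs i) =
      absProductSum A G (x - xs) (x + xs) := sum_congr rfl fun i hi => by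
    rw [absResidual_eq_of_eq_sq (hb i hi), absResidual_eq_of_eq_sq (hb i hi)]
    simp
  have hcorrupted : -absProductSum A Gᶜ (x - xs) (x + xs) ≤
      ∑ i ∈ Gᶜ, (absResidual A b x i - absResidual A b xs i) := by
    rw [absProductSum, ← sum_neg_distrib]
    exact sum_le_sum fun i _ => (abs_le.1 (abs_absResidual_sub_le x xs i)).1
  have hsharp := hU.sharp (x - xs) (x + xs)
  rw [Fintype.card_fin] at hsharp
  rw [mul_objective_sub_objective, ← sum_add_sum_compl G]
  linarith

lemma objective_sub_le (hU : UniformBounds A G g C h q) (hm : 0 < m)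
    (x y : EuclideanSpace ℝ (Fin n)) :
    objective A b x - objective A b y ≤ C * (‖x - y‖ * ‖x + y‖) := by
  refine le_of_mul_le_mul_left ?_ (Nat.cast_pos.2 hm : (0 : ℝ) < m)
  have hupper := hU.upper (x - y) (x + y)
  rw [Fintype.card_fin, mul_assoc] at hupper
  rw [mul_objective_sub_objective]
  exact (sum_le_sum fun i _ => (abs_le.1 (abs_absResidual_sub_le x y i)).2).trans hupper

lemma mul_le_orderStat_absResidual (hU : UniformBounds A G g C h q)
    (hb : ∀ i ∈ G, b i = ⟪A i, xs⟫ ^ 2) (hk : 1 ≤ k) (hkm : k ≤ m) (hq : m - k ≤ m * q)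
    (x : EuclideanSpace ℝ (Fin n)) :
    h * (‖x - xs‖ * ‖x + xs‖) ≤ orderStat (absResidual A b x) k := by
  rw [le_orderStat_iff hk hkm]
  set τ := h * (‖x - xs‖ * ‖x + xs‖)
  have hdisj : Disjoint {i ∈ G | τ ≤ |⟪A i, x - xs⟫ * ⟪A i, x + xs⟫|}
      ({i | absResidual A b x i < τ} : Finset (Fin m)) := by
    refine disjoint_left.2 fun i hi hi' => ?_
    rw [mem_filter] at hi hi'
    rw [absResidual_eq_of_eq_sq (hb i hi.1)] at hi'
    exact hi.2.not_gt hi'.2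
  have hcard := (card_union_of_disjoint hdisj).symm.trans_le (card_le_univ _)
  rw [Fintype.card_fin] at hcard
  have hcount := hU.count (x - xs) (x + xs)
  rw [Fintype.card_fin] at hcount
  have hlarge : m < #{i ∈ G | τ ≤ |⟪A i, x - xs⟫ * ⟪A i, x + xs⟫|} + k := by
    rw [← Nat.cast_lt (α := ℝ), Nat.cast_add]
    linarith
  omega

lemma orderStat_absResidual_le (hU : UniformBounds A G g C h q)
    (hb : ∀ i ∈ G, b i = ⟪A i, xs⟫ ^ 2) (hk : 1 ≤ k) (hkm : k ≤ m) (hη : 0 < η)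
    (hG : m * η + k ≤ #G) (x : EuclideanSpace ℝ (Fin n)) :
    orderStat (absResidual A b x) k ≤ C / η * (‖x - xs‖ * ‖x + xs‖) := by
  have hm : (0 : ℝ) < m := Nat.cast_pos.2 (hk.trans hkm)
  refine le_of_mul_le_mul_left ?_ (mul_pos hm hη)
  calc m * η * orderStat (absResidual A b x) k
      ≤ (#G - k) * orderStat (absResidual A b x) k :=
        mul_le_mul_of_nonneg_right (by linarith) (orderStat_nonneg fun _ => abs_nonneg _)
    _ ≤ ∑ i ∈ G, absResidual A b x i :=
        card_sub_mul_orderStat_le_sum hk hkm (fun _ => abs_nonneg _) G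
    _ = absProductSum A G (x - xs) (x + xs) :=
        sum_congr rfl fun i hi => absResidual_eq_of_eq_sq (hb i hi) x
    _ ≤ m * C * (‖x - xs‖ * ‖x + xs‖) := by
        simpa only [Fintype.card_fin] using
          (absProductSum_le_univ A G _ _).trans (hU.upper (x - xs) (x + xs))
    _ = m * η * (C / η * (‖x - xs‖ * ‖x + xs‖)) := by field_simp

theorem quantile_mem_Icc (hU : UniformBounds A G g C h (1 - p)) (hg : 0 < g) (hC : 0 < C)
    (hh : 0 < h) (hm : 0 < m) (hp : 0 < p) (hp1 : p ≤ 1) (hk : ∃ k : ℕ, m * p = k) (hη : 0 < η)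
    (hG : m * (η + p) ≤ #G) (hb : ∀ i ∈ G, b i = ⟪A i, xs⟫ ^ 2) (x : EuclideanSpace ℝ (Fin n)) :
    quantile (absResidual A b x) p ∈
      Set.Icc (h / C * (objective A b x - objective A b xs))
        (C / η / g * (objective A b x - objective A b xs)) := by
  obtain ⟨k, hk⟩ := hk
  have hm' : (0 : ℝ) < m := Nat.cast_pos.2 hm
  have hk1 : 1 ≤ k := by exact_mod_cast hk ▸ mul_pos hm' hp
  have hkm : k ≤ m := by exact_mod_cast hk ▸ mul_le_of_le_one_right hm'.le hp1
  rw [quantile, hk, Nat.floor_natCast]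
  constructor
  · calc h / C * (objective A b x - objective A b xs)
        ≤ h / C * (C * (‖x - xs‖ * ‖x + xs‖)) := by gcongr; exact hU.objective_sub_le hm x xs
      _ = h * (‖x - xs‖ * ‖x + xs‖) := by field_simp
      _ ≤ _ := hU.mul_le_orderStat_absResidual hb hk1 hkm (by linarith) x
  · calc orderStat (absResidual A b x) k
        ≤ C / η * (‖x - xs‖ * ‖x + xs‖) :=
          hU.orderStat_absResidual_le hb hk1 hkm hη (by linarith) x
      _ = C / η / g * (g * (‖x - xs‖ * ‖x + xs‖)) := by field_simp
      _ ≤ _ := by gcongr; exact hU.mul_le_objective_sub hm hb x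

end UniformBounds

end QuantileComparison

section NetProbability

open Finset

variable {E : Type*} [NormedAddCommGroup E] [InnerProductSpace ℝ E] [MeasurableSpace E]
  {ν : Measure E} {ι : Type*} [Fintype ι] [DecidableEq ι] {G : Finset ι}
  {l₀ K S κst κ p₀ t : ℝ} {s : Finset E}

lemma HasProductMoments.netEstimates {A : ι → E} (hν : HasProductMoments ν l₀ K S κst κ p₀)
    (hs : ∀ u ∈ s, ‖u‖ = 1)
    (hclean : ∀ u ∈ s, ∀ v ∈ s,
      #G * ∫ y, |⟪y, u⟫ * ⟪y, v⟫| ∂ν ≤ absProductSum A G u v + Fintype.card ι * t)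
    (hcorrupted : ∀ u ∈ s, ∀ v ∈ s,
      absProductSum A Gᶜ u v ≤ #Gᶜ * ∫ y, |⟪y, u⟫ * ⟪y, v⟫| ∂ν + Fintype.card ι * t)
    (hsquare : ∀ u ∈ s, ∀ v ∈ s, absProductSum A univ u v ≤
      Fintype.card ι * ∫ y, |⟪y, u⟫ * ⟪y, v⟫| ∂ν + Fintype.card ι * t)
    (hsmall : ∀ u ∈ s, ∀ v ∈ s, #G * ν.real {y | κ ≤ min |⟪y, u⟫| |⟪y, v⟫|} ≤
      #{i ∈ G | κ ≤ min |⟪A i, u⟫| |⟪A i, v⟫|} + Fintype.card ι * t) :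
    NetEstimates A G S κst κ p₀ t s where
  clean u hu v hv := by
    have := mul_le_mul_of_nonneg_left (hν.le_integral u v (hs u hu) (hs v hv))
      (Nat.cast_nonneg (α := ℝ) #G)
    linarith [hclean u hu v hv]
  corrupted u hu v hv := by
    have := mul_le_mul_of_nonneg_left (hν.integral_le u v (hs u hu) (hs v hv))
      (Nat.cast_nonneg (α := ℝ) #Gᶜ)
    linarith [hcorrupted u hu v hv]
  square u hu := by
    have hsq : absProductSum A univ u u = ∑ i, ⟪A i, u⟫ ^ 2 :=
      sum_congr rfl fun i _ => by rw [abs_mul_self, sq]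
    have := mul_le_mul_of_nonneg_left (hν.integral_le u u (hs u hu) (hs u hu))
      (Nat.cast_nonneg (α := ℝ) (Fintype.card ι))
    linarith [hsquare u hu u hu]
  smallBall u hu v hv := by
    have := mul_le_mul_of_nonneg_left (hν.le_measureReal u v (hs u hu) (hs v hv))
      (Nat.cast_nonneg (α := ℝ) #G)
    linarith [hsmall u hu v hv]

variable {Ω : Type*} [MeasurableSpace Ω] {μ : Measure Ω} [IsProbabilityMeasure μ]
  [OpensMeasurableSpace E] [IsProbabilityMeasure ν] {a : ι → Ω → E}

theorem HasProductMoments.measureReal_not_netEstimates_le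
    (hν : HasProductMoments ν l₀ K S κst κ p₀) (ha : ∀ i, Measurable (a i))
    (hlaw : ∀ i, μ.map (a i) = ν) (hind : iIndepFun a μ) (hs : ∀ u ∈ s, ‖u‖ = 1) (hl₀ : 0 < l₀)
    (hK : Real.exp l₀ ≤ K) (ht : 0 < t) :
    μ.real {ω | ¬ NetEstimates (fun i => a i ω) G S κst κ p₀ t s} ≤
      #s ^ 2 * (4 * Real.exp (-(Fintype.card ι * chernoffRate l₀ K t))) := by
  let P : E × E → E → ℝ := fun p y => |⟪y, p.1⟫ * ⟪y, p.2⟫|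
  let T : E × E → Set E := fun p => {y | κ ≤ min |⟪y, p.1⟫| |⟪y, p.2⟫|}
  have hT (p : E × E) : MeasurableSet (T p) :=
    measurableSet_le measurable_const (Continuous.measurable (by fun_prop))
  have hP : ∀ p ∈ s ×ˢ s, HasExpMoment (P p) l₀ K ν := fun p hp =>
    (hν.hasExpMoment p.1 p.2 (hs _ (mem_product.1 hp).1) (hs _ (mem_product.1 hp).2)).abs
  have hI : ∀ p ∈ s ×ˢ s, HasExpMoment ((T p).indicator 1) l₀ K ν := fun p _ =>
    (HasExpMoment.of_abs_le_one (measurable_one.indicator (hT p))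
      (fun y => by by_cases hy : y ∈ T p <;> simp [hy]) hl₀.le).mono hK
  have hK0 : 0 < K := (Real.exp_pos l₀).trans_le hK
  have hcard (I : Finset ι) : (#I : ℝ) ≤ Fintype.card ι := Nat.cast_le.2 (card_le_univ I)
  have hclean := HasExpMoment.measureReal_exists_sum_add_le_le hP ha hlaw hind hl₀ hK0 ht (hcard G)
  have hcorrupted :=
    HasExpMoment.measureReal_exists_add_le_sum_le hP ha hlaw hind hl₀ hK0 ht (hcard Gᶜ)
  have hsquare :=
    HasExpMoment.measureReal_exists_add_le_sum_le hP ha hlaw hind hl₀ hK0 ht (hcard univ)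
  have hsmall := HasExpMoment.measureReal_exists_sum_add_le_le hI ha hlaw hind hl₀ hK0 ht (hcard G)
  have hsum : ∀ p ω, ∑ i ∈ G, (T p).indicator (1 : E → ℝ) (a i ω) =
      #{i ∈ G | κ ≤ min |⟪a i ω, p.1⟫| |⟪a i ω, p.2⟫|} := fun p ω => by
    simp only [Set.indicator_apply, Pi.one_apply, sum_boole, T, Set.mem_ofPred_eq]
  simp only [integral_indicator_one (hT _), hsum] at hsmall
  refine (measureReal_mono (fun ω hω => ?_)).trans <|
    (measureReal_union_le _ _).trans <| (add_le_add (measureReal_union_le _ _)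
      (measureReal_union_le _ _)).trans <|
        (add_le_add (add_le_add hclean hcorrupted) (add_le_add hsquare hsmall)).trans_eq ?_
  · by_contra hgood
    simp only [Set.mem_union, Set.mem_ofPred_eq, not_or, not_exists, not_and, not_le, mem_product,
      Prod.forall, and_imp, card_univ] at hgood
    obtain ⟨⟨hcleanω, hcorruptedω⟩, hsquareω, hsmallω⟩ := hgood
    exact hω <| hν.netEstimates hs (fun u hu v hv => (hcleanω u v hu hv).le)
      (fun u hu v hv => (hcorruptedω u v hu hv).le) (fun u hu v hv => (hsquareω u v hu hv).le)
      fun u hu v hv => (hsmallω u v hu hv).le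
  · rw [card_product]
    push_cast
    ring

end NetProbability

section HighProbability

open Finset Metric Module Topology

lemma sq_mul_exp_le_of_le_pow {N B M c : ℝ} {n : ℕ} (hN : 0 ≤ N) (hB : 0 < B) (hNB : N ≤ B ^ n)
    (hM : 4 * Real.log B * n ≤ M * c) :
    N ^ 2 * (4 * Real.exp (-(M * c))) ≤ 4 * Real.exp (-(M * (c / 2))) :=
  calc N ^ 2 * (4 * Real.exp (-(M * c))) ≤ (B ^ n) ^ 2 * (4 * Real.exp (-(M * c))) := by gcongr
    _ = 4 * Real.exp (2 * (n * Real.log B) - M * c) := by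
        rw [sub_eq_add_neg, Real.exp_add, two_mul, Real.exp_add, Real.exp_nat_mul,
          Real.exp_log hB]
        ring
    _ ≤ _ := by gcongr; linarith

lemma exists_deviation_radius (S κ : ℝ) {γ δ : ℝ} (hγ : 0 < γ) (hδ : 0 < δ) :
    ∃ (t C : ℝ) (ε : ℝ≥0), 0 < t ∧ 0 < C ∧ 0 < ε ∧ 4 * (S + t) ≤ C ∧ (ε : ℝ) ≤ 1 / 2 ∧
      γ / 2 + 2 * t + 4 * C * ε ≤ γ ∧ t + 2 * C * ε ^ 2 / (κ / 2) ^ 2 < δ := by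
  let t := min (γ / 8) (δ / 2)
  have ht : 0 < t := by positivity
  let C := 4 * (|S| + t)
  have hC : 0 < C := by positivity
  have hsmall {f : ℝ≥0 → ℝ} {r : ℝ} (hf : Continuous f) (hf0 : f 0 = 0) (hr : 0 < r) :
      ∀ᶠ ε in 𝓝[>] 0, f ε < r :=
    ((hf.tendsto 0).mono_left nhdsWithin_le_nhds).eventually_lt_const (hf0.trans_lt hr)
  obtain ⟨ε, hε, hhalf, hsharp, hcount⟩ := (eventually_mem_nhdsWithin.and <|
    (hsmall (f := fun ε => ε) (by fun_prop) (by simp) one_half_pos).and <|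
    (hsmall (f := fun ε => 4 * C * ε) (by fun_prop) (by simp) (by positivity : 0 < γ / 4)).and <|
    hsmall (f := fun ε => 2 * C * ε ^ 2 / (κ / 2) ^ 2) (by fun_prop) (by simp)
      (half_pos hδ)).exists
  refine ⟨t, C, ε, ht, hC, hε, ?_, hhalf.le, ?_, ?_⟩
  · linarith [le_abs_self S]
  · linarith [min_le_left (γ / 8) (δ / 2)]
  · linarith [min_le_right (γ / 8) (δ / 2)]

lemma mul_sub_two_mul_le {G M S κst pfail : ℝ} (hG : (1 - pfail) * M ≤ G) (hGM : G ≤ M)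
    (hS : 0 ≤ κst + S) (hκS : κst ≤ S) :
    M * (κst - 2 * pfail * S) ≤ G * κst - (M - G) * S := by
  have hpM : 0 ≤ pfail * M := by linarith
  linarith [mul_le_mul_of_nonneg_right hG hS, mul_le_mul_of_nonneg_left hκS hpM]

theorem exists_measureReal_not_uniformBounds_le {l₀ K S κst κ p₀ pfail q : ℝ} (hl₀ : 0 < l₀)
    (hK : Real.exp l₀ ≤ K) (hgap : 0 < κst - 2 * pfail * S) (hκ : 0 < κ) (hp₀ : 0 ≤ p₀)
    (hq : q < (1 - pfail) * p₀) :
    ∃ C ρ c : ℝ, 0 < C ∧ 0 < ρ ∧ 0 < c ∧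
      ∀ (E ι Ω : Type*) [NormedAddCommGroup E] [InnerProductSpace ℝ E] [FiniteDimensional ℝ E]
        [Nontrivial E] [MeasurableSpace E] [OpensMeasurableSpace E] [Fintype ι] [DecidableEq ι]
        [MeasurableSpace Ω] (μ : Measure Ω) [IsProbabilityMeasure μ] (ν : Measure E)
        [IsProbabilityMeasure ν] (a : ι → Ω → E) (G : Finset ι),
        (∀ i, Measurable (a i)) → (∀ i, μ.map (a i) = ν) → iIndepFun a μ →
        HasProductMoments ν l₀ K S κst κ p₀ → (1 - pfail) * Fintype.card ι ≤ #G →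
        ρ * finrank ℝ E ≤ Fintype.card ι →
        μ.real {ω | ¬ UniformBounds (fun i => a i ω) G ((κst - 2 * pfail * S) / 2) C
          ((κ / 2) ^ 2) q} ≤ 4 * Real.exp (-(Fintype.card ι * c)) := by
  obtain ⟨t, C, ε, ht, hC, hε, hSC, hhalf, hsharp, hcount⟩ :=
    exists_deviation_radius S κ hgap (sub_pos.2 hq)
  have hB : 1 < 1 + 2 * (1 : ℝ≥0) / (ε : ℝ) := lt_add_of_pos_right 1 (by positivity)
  have hlog := Real.log_pos hB
  have hrate := chernoffRate_pos hl₀ ((Real.exp_pos l₀).trans_le hK) ht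
  set B : ℝ := 1 + 2 * (1 : ℝ≥0) / (ε : ℝ)
  set c := chernoffRate l₀ K t
  refine ⟨C, 4 * Real.log B / c, c / 2, hC, by positivity, by positivity, ?_⟩
  intro E ι Ω _ _ _ _ _ _ _ _ _ μ _ ν _ a G ha hlaw hind hν hG hρ
  have hM : (0 : ℝ) < Fintype.card ι :=
    (mul_pos (by positivity) (Nat.cast_pos.2 finrank_pos)).trans_le hρ
  obtain ⟨u, hu⟩ := exists_norm_eq E zero_le_one
  have hκS : κst ≤ S := (hν.le_integral u u hu hu).trans (hν.integral_le u u hu hu)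
  have hS : 0 ≤ S := (integral_nonneg fun _ => abs_nonneg _).trans (hν.integral_le u u hu hu)
  have hGM : (#G : ℝ) ≤ Fintype.card ι := Nat.cast_le.2 (card_le_univ G)
  have hpfail : 0 ≤ pfail := by nlinarith
  have hκst : 0 ≤ κst := by nlinarith
  obtain ⟨s, hs, hcover, hcard⟩ := exists_finset_isCover_card_le (E := E) (R := 1) hε
    sphere_subset_closedBall
  have hsub (ω : Ω) : NetEstimates (fun i => a i ω) G S κst κ p₀ t s →
      UniformBounds (fun i => a i ω) G ((κst - 2 * pfail * S) / 2) C ((κ / 2) ^ 2) q := by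
    refine fun hnet => hnet.uniformBounds hs hcover hhalf hκ (by linarith) hSC ?_ ?_
    · rw [card_compl, Nat.cast_sub (card_le_univ G)]
      exact (mul_le_mul_of_nonneg_left hsharp hM.le).trans
        (mul_sub_two_mul_le hG hGM (by linarith) hκS)
    · calc Fintype.card ι * (q + t + 2 * C * ε ^ 2 / (κ / 2) ^ 2)
          < Fintype.card ι * ((1 - pfail) * p₀) := by gcongr; linarith
        _ ≤ #G * p₀ := by
          rw [← mul_assoc, mul_comm (Fintype.card ι : ℝ)]
          gcongr
  refine (measureReal_mono fun ω => mt (hsub ω)).trans <|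
    (hν.measureReal_not_netEstimates_le ha hlaw hind
      (fun u hu => mem_sphere_zero_iff_norm.1 (hs hu)) hl₀ hK ht).trans <|
    sq_mul_exp_le_of_le_pow (Nat.cast_nonneg _) (by linarith) hcard ?_
  rwa [div_mul_eq_mul_div, div_le_iff₀ hrate] at hρ

end HighProbability

section Events

lemma exp_one_div_four_mul_sq_add_one_le (σ : ℝ) : Real.exp (1 / (4 * (σ ^ 2 + 1))) ≤ 2 := by
  rw [← Real.le_log_iff_exp_le two_pos, div_le_iff₀ (by positivity)]
  nlinarith [Real.log_two_gt_d9, sq_nonneg σ]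

lemma one_sub_le_measureReal_of_compl {Ω : Type*} [MeasurableSpace Ω] {μ : Measure Ω}
    [IsProbabilityMeasure μ] {s : Set Ω} {r : ℝ} (h : μ.real sᶜ ≤ r) : 1 - r ≤ μ.real s := by
  have hunion := measureReal_union_le (μ := μ) s sᶜ
  rw [Set.union_compl_self, probReal_univ] at hunion
  linarith

variable {n m₁ m₂ : ℕ}

/-- The indices of the exact measurements. -/
def cleanIndices (m₁ m₂ : ℕ) : Finset (Fin (m₁ + m₂)) := {i | (i : ℕ) < m₁}

lemma card_cleanIndices : (cleanIndices m₁ m₂).card = m₁ := by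
  simp [cleanIndices, Fin.card_filter_val_lt]

lemma measurements_of_mem_cleanIndices (A : Fin (m₁ + m₂) → EuclideanSpace ℝ (Fin n))
    (xs : EuclideanSpace ℝ (Fin n)) (ξ : Fin m₂ → ℝ) {i : Fin (m₁ + m₂)}
    (hi : i ∈ cleanIndices m₁ m₂) : measurements A xs ξ i = ⟪A i, xs⟫ ^ 2 := by
  have hi' : i = Fin.castAdd m₂ ⟨i, (Finset.mem_filter.1 hi).2⟩ := Fin.ext rfl
  rw [hi', measurements, Fin.append_left]

end Events

end RobustPhaseRetrieval

theorem mainTheorem1_general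
    (σ : ℝ≥0) (S κst κ p₀ pfail ptil : ℝ)
    (hgap : 0 < κst - 2 * pfail * S)
    (hptil : ptil ∈ Set.Ioo pfail (1 - pfail))
    (hκ : 0 < κ)
    (hp₀ : (1 - ptil) / (1 - pfail) < p₀) :
    ∃ uL uH ρ₁ ρ₂ ρ₃ : ℝ, 0 < uL ∧ 0 < uH ∧ 0 < ρ₁ ∧ 0 < ρ₂ ∧ 0 < ρ₃ ∧
      ∀ (n m : ℕ) (Ω : Type*) [MeasurableSpace Ω] (μ : Measure Ω) [IsProbabilityMeasure μ]
        (ν : Measure (EuclideanSpace ℝ (Fin n))) (a : Fin m → Ω → EuclideanSpace ℝ (Fin n))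
        (G : Finset (Fin m)),
        0 < n → (∀ i, Measurable (a i)) → (∀ i, μ.map (a i) = ν) → iIndepFun a μ →
        IsSubGaussian ν σ →
        specNorm (covarianceMatrix ν) ≤ S →
        κst ≤ kappaSt ν →
        p₀ ≤ smallBallProb ν κ →
        (1 - pfail) * m ≤ G.card →
        (∃ k : ℕ, m * ptil = k) →
        ρ₁ * n ≤ m →
        1 - ρ₂ * Real.exp (-(m * ρ₃)) ≤
          μ.real {ω | ∀ (xs : EuclideanSpace ℝ (Fin n)) (b : Fin m → ℝ),
            (∀ i ∈ G, b i = ⟪a i ω, xs⟫ ^ 2) → ∀ x : EuclideanSpace ℝ (Fin n),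
            quantile (absResidual (fun i => a i ω) b x) ptil ∈
              Set.Icc (uL * (objective (fun i => a i ω) b x - objective (fun i => a i ω) b xs))
                (uH * (objective (fun i => a i ω) b x - objective (fun i => a i ω) b xs))} := by
  obtain ⟨hlow, hupp⟩ := hptil
  have hpfail : 0 < 1 - pfail := by linarith
  have hq : 1 - ptil < (1 - pfail) * max p₀ 0 :=
    (div_lt_iff₀' hpfail).1 (hp₀.trans_le (le_max_left _ _))
  have hη : 0 < 1 - pfail - ptil := by linarith
  have hmoment := exp_one_div_four_mul_sq_add_one_le σ
  obtain ⟨C, ρ, c, hC, hρ, hc, hprob⟩ := exists_measureReal_not_uniformBounds_le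
    (by positivity) hmoment hgap hκ (le_max_right p₀ 0) hq
  refine ⟨(κ / 2) ^ 2 / C, C / (1 - pfail - ptil) / ((κst - 2 * pfail * S) / 2), ρ, 4, c,
    by positivity, by positivity, hρ, four_pos, hc, ?_⟩
  intro n m Ω _ μ _ ν a G hn ha hlaw hind hν hS hκst hp₀' hG hk hm
  have hm0 : 0 < m := Nat.cast_pos.1 <| (mul_pos hρ (Nat.cast_pos.2 hn)).trans_le hm
  have hGm : (G.card : ℝ) ≤ m := by simpa using G.card_le_univ
  have hpfail0 : 0 ≤ pfail := by nlinarith [Nat.cast_pos (α := ℝ).2 hm0]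
  have : Nonempty (Fin n) := ⟨⟨0, hn⟩⟩
  have : IsProbabilityMeasure ν :=
    hlaw ⟨0, hm0⟩ ▸ Measure.isProbabilityMeasure_map (ha _).aemeasurable
  have hbounds := hprob (EuclideanSpace ℝ (Fin n)) (Fin m) Ω μ ν a G ha hlaw hind
    (hν.hasProductMoments.mono hS hκst (max_le hp₀' smallBallProb_nonneg))
    (by simpa using hG) (by simpa using hm)
  rw [Fintype.card_fin] at hbounds
  refine one_sub_le_measureReal_of_compl <| (measureReal_mono fun ω => mt ?_).trans hbounds
  exact fun hU xs b hb x => hU.quantile_mem_Icc (half_pos hgap) hC (by positivity) hm0 (by linarith)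
    (by linarith) hk hη (by linarith) hb x

theorem mainTheorem1
    (σ : ℝ≥0) (S κst κ p₀ pfail ptil : ℝ)
    (hpfail : pfail < 1 / 2)
    (hgap : 0 < κst - 2 * pfail * S)
    (hptil : ptil ∈ Set.Ioo pfail (1 - pfail))
    (hκ : 0 < κ)
    (hp₀ : (1 - ptil) / (1 - pfail) < p₀) :
    ∃ uL uH ρ₁ ρ₂ ρ₃ : ℝ, 0 < uL ∧ 0 < uH ∧ 0 < ρ₁ ∧ 0 < ρ₂ ∧ 0 < ρ₃ ∧
      ∀ (n m₁ m₂ : ℕ) (Ω : Type*) [MeasurableSpace Ω] (μ : Measure Ω) [IsProbabilityMeasure μ]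
        (ν : Measure (EuclideanSpace ℝ (Fin n)))
        (a : Fin (m₁ + m₂) → Ω → EuclideanSpace ℝ (Fin n)) (ξ : Fin m₂ → Ω → ℝ)
        (xs : EuclideanSpace ℝ (Fin n)),
        DataModel μ ν σ a ξ xs →
        pfail = (m₂ : ℝ) / ((m₁ + m₂ : ℕ) : ℝ) →
        S = specNorm (covarianceMatrix ν) →
        κst = kappaSt ν →
        p₀ = smallBallProb ν κ →
        (∃ k : ℕ, ((m₁ + m₂ : ℕ) : ℝ) * ptil = k) →
        ρ₁ * (n : ℝ) ≤ ((m₁ + m₂ : ℕ) : ℝ) →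
        1 - ρ₂ * Real.exp (-(((m₁ + m₂ : ℕ) : ℝ) * ρ₃)) ≤
          μ.real {ω | ∀ x : EuclideanSpace ℝ (Fin n),
            let A : Fin (m₁ + m₂) → EuclideanSpace ℝ (Fin n) := fun i => a i ω
            let b : Fin (m₁ + m₂) → ℝ := measurements A xs (fun j => ξ j ω)
            quantile (absResidual A b x) ptil ∈
              Set.Icc (uL * (objective A b x - objective A b xs))
                (uH * (objective A b x - objective A b xs))} := by
  obtain ⟨uL, uH, ρ₁, ρ₂, ρ₃, huL, huH, hρ₁, hρ₂, hρ₃, h⟩ :=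
    mainTheorem1_general σ S κst κ p₀ pfail ptil hgap hptil hκ hp₀
  refine ⟨uL, uH, ρ₁, ρ₂, ρ₃, huL, huH, hρ₁, hρ₂, hρ₃, ?_⟩
  intro n m₁ m₂ Ω _ μ _ ν a ξ xs hdata hpf hS hκst hp₀' hk hm
  have hn : 0 < n := Nat.pos_of_ne_zero fun hn => hdata.signal_ne_zero <| by
    subst hn
    exact Subsingleton.elim _ _
  have hG : (1 - pfail) * ((m₁ + m₂ : ℕ) : ℝ) ≤ (cleanIndices m₁ m₂).card := by
    have hm0 : (0 : ℝ) < (m₁ + m₂ : ℕ) := (mul_pos hρ₁ (Nat.cast_pos.2 hn)).trans_le hm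
    rw [card_cleanIndices, hpf, sub_mul, div_mul_cancel₀ _ hm0.ne']
    simp
  exact (h n (m₁ + m₂) Ω μ ν a (cleanIndices m₁ m₂) hn hdata.measurable_a hdata.law_a hdata.indep_a
    hdata.subGaussian hS.ge hκst.le hp₀'.le hG hk hm).trans <| measureReal_mono fun ω hω =>
      hω xs _ fun i hi => measurements_of_mem_cleanIndices _ xs _ hi
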